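/- A knot is a smoothly embedded oriented circle in $\mathbb{R}^3\subset S^3=\mathbb{R}^3\cup\{\infty\}$, and knots are considered up to orientation-respecting smooth ambient isotopy. For a knot $K$ let $-K$ be its reversed mirror image: the image of $K$ under $(x,y,z)\mapsto(x,y,-z)$, with the opposite orientation. The connected sum $K_1\# K_2$ is the isotopy class of knots obtained by removing a trivial ball–arc pair from each of $(S^3,K_1)$ and $(S^3,K_2)$ and gluing the remaining pairs along their boundary spheres, compatibly with the orientations of space and of the arcs. Let $\mathbb{R}^4_+=\{x\in\mathbb{R}^4 : x_4\ge 0\}$, with boundary $\mathbb{R}^3\times\{0\}$. **Proposition.** For every knot $K$, every knot $J$ representing the connected sum $K\#-K$ is the boundary of a smoothly and properly embedded disk in $\mathbb{R}^4_+$. That is, there is a smooth embedding $\varphi: D^2\to\mathbb{R}^4_+$ of the closed unit disk that sends the open disk into $\{x_4>0\}$, satisfies $\varphi(\partial D^2)=J\times\{0\}$, and is transverse to $\mathbb{R}^3\times\{0\}$ along $\partial D^2$. -/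

import Mathlib

open scoped ContDiff Manifold

/-- Euclidean 3-space, the ambient space of knots. -/
abbrev E3 : Type := EuclideanSpace ℝ (Fin 3)

/-- Euclidean 4-space. The half-space `ℝ⁴₊` consists of the points with `0 ≤ x 3`, its boundary
`ℝ³ × {0}` of those with `x 3 = 0`. -/
abbrev E4 : Type := EuclideanSpace ℝ (Fin 4)

/-- The inclusion of `ℝ³` in `ℝ⁴` as `ℝ³ × {0}`, the boundary of `ℝ⁴₊`. -/
noncomputable def inclE3 (x : E3) : E4 := !₂[x 0, x 1, x 2, 0]

/-- A smooth oriented knot: a smooth embedding of the circle `ℝ / ℤ` in `ℝ³`, written as a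
1-periodic smooth curve that is injective modulo the period and has nowhere vanishing
velocity. The orientation is that of the parametrization. -/
structure OrientedKnot where
  toFun : ℝ → E3
  smooth : ContDiff ℝ ∞ toFun
  periodic : Function.Periodic toFun 1
  injective : ∀ s t : ℝ, toFun s = toFun t → ∃ n : ℤ, t = s + n
  immersion : ∀ t : ℝ, deriv toFun t ≠ 0

/-- The reflection `m (x, y, z) = (x, y, -z)` of `ℝ³`. -/
noncomputable def mirror (x : E3) : E3 := !₂[x 0, x 1, -x 2]

theorem mirror_mirror (x : E3) : mirror (mirror x) = x := by
  ext i
  fin_cases i <;> simp [mirror]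

/-- The reflection `mirror` as a continuous linear map. -/
noncomputable def mirrorCLM : E3 →L[ℝ] E3 :=
  LinearMap.toContinuousLinearMap
    { toFun := mirror
      map_add' := fun x y => by
        ext i
        fin_cases i <;> simp [mirror]
        ring
      map_smul' := fun c x => by
        ext i
        fin_cases i <;> simp [mirror] }

theorem mirrorCLM_apply (x : E3) : mirrorCLM x = mirror x := rfl

/-- The knot `-K`: the mirror image `m(K)` with the orientation opposite to that of `K`. -/
noncomputable def OrientedKnot.mirrorReverse (K : OrientedKnot) : OrientedKnot where
  toFun t := mirror (K.toFun (-t))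
  smooth := mirrorCLM.contDiff.comp (K.smooth.comp contDiff_neg)
  periodic := fun t => by
    have h := K.periodic (-(t + 1))
    simp only [neg_add_rev, neg_add_cancel_comm] at h
    simp only [neg_add_rev]
    exact congrArg mirror h.symm
  injective := fun s t h => by
    have h' : K.toFun (-s) = K.toFun (-t) := by
      rw [← mirror_mirror (K.toFun (-s)), h, mirror_mirror]
    obtain ⟨n, hn⟩ := K.injective _ _ h'
    exact ⟨-n, by push_cast; linarith⟩
  immersion := fun t h => by
    have hK : HasDerivAt K.toFun (deriv K.toFun (-t)) (-t) :=
      (K.smooth.differentiable (by simp) (-t)).hasDerivAt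
    have h1 : HasDerivAt (fun s : ℝ => K.toFun (-s)) ((-1 : ℝ) • deriv K.toFun (-t)) t :=
      hK.scomp t (hasDerivAt_neg t)
    have h2 : HasDerivAt (fun s : ℝ => mirror (K.toFun (-s)))
        (mirrorCLM ((-1 : ℝ) • deriv K.toFun (-t))) t :=
      mirrorCLM.hasFDerivAt.comp_hasDerivAt t h1
    rw [h2.deriv, mirrorCLM_apply] at h
    have h3 : (-1 : ℝ) • deriv K.toFun (-t) = 0 := by
      rw [← mirror_mirror ((-1 : ℝ) • deriv K.toFun (-t)), h, ← mirrorCLM_apply, map_zero]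
    exact K.immersion (-t) (by simpa using h3)

/-- Equivalence of oriented knots: a smooth ambient isotopy of `ℝ³`, starting at the identity,
carries `K₀` to `K₁` with its orientation. Here `h` is a lift of an orientation-preserving
diffeomorphism of `ℝ / ℤ`. -/
def OrientedKnot.Isotopic (K₀ K₁ : OrientedKnot) : Prop :=
  ∃ F : ℝ → E3 → E3,
    ContDiffOn ℝ ∞ (fun p : ℝ × E3 => F p.1 p.2) (Set.Icc 0 1 ×ˢ Set.univ) ∧
    (∀ t ∈ Set.Icc (0 : ℝ) 1, ∃ Φ : Diffeomorph 𝓘(ℝ, E3) 𝓘(ℝ, E3) E3 E3 ∞, ⇑Φ = F t) ∧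
    (∀ x : E3, F 0 x = x) ∧
    ∃ h : ℝ → ℝ, ContDiff ℝ ∞ h ∧ (∀ t, 0 < deriv h t) ∧ (∀ t, h (t + 1) = h t + 1) ∧
      ∀ t, F 1 (K₀.toFun t) = K₁.toFun (h t)

/-- The first unit coordinate vector `e` of `ℝ³`. -/
noncomputable def axis : E3 := EuclideanSpace.single 0 1

/-- The position of a summand before the connected sum is formed: in the ball of radius `2` the
knot is the diameter along the first axis, so that the closed unit ball and the knot in it form
a trivial ball-arc pair; the knot runs through this pair, from `-e` to `e`, during the times
`[0, 1/2]`, and through the exterior of the unit ball during `[1/2, 1]`. -/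
structure OrientedKnot.InSumPosition (k : OrientedKnot) : Prop where
  straight : Set.range k.toFun ∩ Metric.closedBall 0 2 =
    {p : E3 | ∃ x : ℝ, |x| ≤ 2 ∧ p = x • axis}
  enter : k.toFun 0 = -axis
  leave : k.toFun (1 / 2) = axis
  inside : ∀ t ∈ Set.Ioo (0 : ℝ) (1 / 2), ‖k.toFun t‖ < 1

/-- The map `(x, y, z) ↦ (-x, y, z) / ‖(x, y, z)‖²`, an inversion followed by a reflection. It is
an orientation-preserving diffeomorphism from the exterior of the open unit ball onto the
closed unit ball without its centre (which corresponds to the point at infinity of `S³`), and on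
the unit sphere it is the reflection that interchanges `e` and `-e`. -/
noncomputable def gluing (p : E3) : E3 := (‖p‖ ^ 2)⁻¹ • !₂[-p 0, p 1, p 2]

/-- `J` is a connected sum `K₁ # K₂` of oriented knots. Up to isotopy, `K₁` and `K₂` each run
through the unit ball along a diameter; from each of `(S³, K₁)`, `(S³, K₂)` this trivial
ball-arc pair is removed, and what remains is glued along the boundary spheres by `gluing`, which
keeps the orientations of space and of the arcs. Thus the resulting knot first runs through the
image of the exterior arc of `K₂` and then through the exterior arc of `K₁`. (The
parametrizations of `k₁` and `k₂` can be chosen so that the joint one is smooth.) `J` is any knot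
isotopic to the result. -/
def OrientedKnot.IsConnectedSum (K₁ K₂ J : OrientedKnot) : Prop :=
  ∃ k₁ k₂ j : OrientedKnot,
    K₁.Isotopic k₁ ∧ K₂.Isotopic k₂ ∧ J.Isotopic j ∧
    k₁.InSumPosition ∧ k₂.InSumPosition ∧
    (∀ t ∈ Set.Icc (0 : ℝ) (1 / 2), j.toFun t = gluing (k₂.toFun (t + 1 / 2))) ∧
    (∀ t ∈ Set.Icc (1 / 2 : ℝ) 1, j.toFun t = k₁.toFun t)

/-- The closed unit disk `D²`. -/
def disk : Set (EuclideanSpace ℝ (Fin 2)) := Metric.closedBall 0 1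

/-- The knot `K ⊂ ℝ³ × {0}` is the boundary of a smoothly and properly embedded disk in `ℝ⁴₊`:
there is a smooth injective immersion `φ` of the closed disk that sends the open disk to the
interior of `ℝ⁴₊`, sends the boundary circle onto `K`, and is transverse to `ℝ³ × {0}` there. -/
def OrientedKnot.BoundsDisk (K : OrientedKnot) : Prop :=
  ∃ φ : EuclideanSpace ℝ (Fin 2) → E4,
    ContDiffOn ℝ ∞ φ disk ∧
    Set.InjOn φ disk ∧
    (∀ p ∈ disk, Function.Injective (fderivWithin ℝ φ disk p)) ∧
    (∀ p ∈ Metric.ball (0 : EuclideanSpace ℝ (Fin 2)) 1, 0 < φ p 3) ∧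
    φ '' Metric.sphere 0 1 = inclE3 '' Set.range K.toFun ∧
    (∀ p ∈ Metric.sphere (0 : EuclideanSpace ℝ (Fin 2)) 1,
      ∃ v, fderivWithin ℝ φ disk p v 3 ≠ 0)

/-! ### Orientation-preserving diffeomorphisms and perturbations of the identity. -/

section Diffeomorphisms

variable {E : Type*} [NormedAddCommGroup E] [NormedSpace ℝ E]

/-! The disk is obtained by half-spinning. Describe `ℝ³ ∖ {0}` by log‖x‖ and x/‖x‖. The arc α of
`k₁` outside the unit ball has its ends on the unit sphere, where log‖x‖ = 0. Keep x/‖x‖ fixed and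
rotate log‖x‖ through a half turn into the fourth coordinate: α sweeps out a disk in the half-space
whose boundary is α together with its image under the inversion x ↦ x/‖x‖². For this disk to be
smooth, α is reparametrized as s ↦ exp(b(s)√(1 - s²)) u(s) with smooth b and u
(`exists_spun_coordinates`); the point (S, P, Q) of the hemisphere Q ≥ 0 then goes to (exp(b(S)P)
u(S), b(S)Q) (`boundsDisk_of_arc`).

To identify the boundary with `J`, take a diffeomorphism f of `ℝ³` that carries `k₁` to `k₂` and
equals `reflectCLM` on the unit ball (`exists_standard_diffeo`). Then `gluing` ∘ f sends α to the
glued arc of `k₂`. On the inverted copy of α the two reflections cancel and an inversion remains,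
which gives back α. So `gluing` ∘ f carries the boundary curve to `j`, and the end of an ambient
isotopy links `j` to `J`. These maps act on the first three coordinates only, so the disk is carried
along.

A first candidate for f is `mirror` composed with the end maps of the two isotopies. It is corrected
in four moves: slide a point along the knot, normalize the derivative there, normalize the germ by a
cutoff, and blow the good ball up to the unit ball. The derivative can be normalized because the
candidate reverses both space and knot: after composition with `reflectCLM` it has positive
determinant and preserves the direction of the axis, so its derivative lies in a connected group. -/

theorem ContinuousLinearMap.det_mul' (A B : E →L[ℝ] E) : (A.comp B).det = A.det * B.det := by
  simp [ContinuousLinearMap.det, LinearMap.det_comp]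

theorem fderiv_eq_id_of_leftInverse {F : Type*} [NormedAddCommGroup F] [NormedSpace ℝ F]
    {f : E → F} {g : F → E} {x : E} (h : ∀ᶠ y in nhds x, g (f y) = y)
    (hf : DifferentiableAt ℝ f x) (hg : DifferentiableAt ℝ g (f x)) :
    (fderiv ℝ g (f x)).comp (fderiv ℝ f x) = ContinuousLinearMap.id ℝ E := by
  rw [← fderiv_comp x hg hf, ← fderiv_id (𝕜 := ℝ) (x := x)]
  exact Filter.EventuallyEq.fderiv_eq h

variable (E) in
/-- The group of orientation-preserving diffeomorphisms of `E`. -/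
def orientedDiffeo : Subgroup (Equiv.Perm E) where
  carrier := {f | ContDiff ℝ ∞ f ∧ ContDiff ℝ ∞ f.symm ∧ ∀ x, 0 < (fderiv ℝ f x).det}
  mul_mem' := by
    rintro f g ⟨hf, hf', df⟩ ⟨hg, hg', dg⟩
    refine ⟨hf.comp hg, hg'.comp hf', fun x => ?_⟩
    have : fderiv ℝ (⇑(f * g)) x = (fderiv ℝ f (g x)).comp (fderiv ℝ g x) :=
      fderiv_comp x (hf.differentiable (by simp) _) (hg.differentiable (by simp) _)
    rw [this, ContinuousLinearMap.det_mul']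
    exact mul_pos (df _) (dg _)
  one_mem' := by
    refine ⟨contDiff_id, contDiff_id, fun x => ?_⟩
    have : fderiv ℝ (⇑(1 : Equiv.Perm E)) x = ContinuousLinearMap.id ℝ E := fderiv_id
    rw [this]
    simp [ContinuousLinearMap.det]
  inv_mem' := by
    rintro f ⟨hf, hf', df⟩
    refine ⟨hf', hf, fun x => ?_⟩
    have h := fderiv_eq_id_of_leftInverse (f := f.symm) (g := f) (x := x)
      (Filter.Eventually.of_forall fun y => f.apply_symm_apply y)
      (hf'.differentiable (by simp) _) (hf.differentiable (by simp) _)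
    have h2 := congrArg ContinuousLinearMap.det h
    rw [ContinuousLinearMap.det_mul'] at h2
    have h3 : (ContinuousLinearMap.id ℝ E).det = 1 := by simp [ContinuousLinearMap.det]
    rw [h3] at h2
    have h4 := df (f.symm x)
    change 0 < (fderiv ℝ f.symm x).det
    by_contra hc
    push Not at hc
    nlinarith

theorem orientedDiffeo.contDiff {f : Equiv.Perm E} (hf : f ∈ orientedDiffeo E) :
    ContDiff ℝ ∞ f := hf.1

theorem orientedDiffeo.contDiff_symm {f : Equiv.Perm E} (hf : f ∈ orientedDiffeo E) :
    ContDiff ℝ ∞ f.symm := hf.2.1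

theorem orientedDiffeo.differentiable {f : Equiv.Perm E} (hf : f ∈ orientedDiffeo E) :
    Differentiable ℝ f := hf.1.differentiable (by simp)

theorem orientedDiffeo.differentiable_symm {f : Equiv.Perm E} (hf : f ∈ orientedDiffeo E) :
    Differentiable ℝ f.symm := hf.2.1.differentiable (by simp)

/-- The tangent map of `f` carries exactly the set `S` of tangent vectors to `T`. -/
def Carries (f : E → E) (S T : Set (E × E)) : Prop :=
  ∀ x v, (x, v) ∈ S ↔ (f x, fderiv ℝ f x v) ∈ T

theorem Carries.comp {f g : E → E} {S T U : Set (E × E)} (hg : Carries g T U)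
    (hf : Carries f S T) (dg : Differentiable ℝ g) (df : Differentiable ℝ f) :
    Carries (g ∘ f) S U := fun x v => by
  rw [hf x v, hg, fderiv_comp x (dg _) (df _)]
  rfl

theorem Carries.mul {f g : Equiv.Perm E} {S T U : Set (E × E)} (hg : Carries g T U)
    (hf : Carries f S T) (dg : g ∈ orientedDiffeo E) (df : f ∈ orientedDiffeo E) :
    Carries (⇑(g * f)) S U :=
  hg.comp hf (orientedDiffeo.differentiable dg) (orientedDiffeo.differentiable df)

theorem Carries.symm {f : Equiv.Perm E} {S T : Set (E × E)} (hf : Carries f S T)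
    (df : Differentiable ℝ f) (df' : Differentiable ℝ f.symm) : Carries f.symm T S := fun x v => by
  have h := fderiv_eq_id_of_leftInverse (f := f.symm) (g := f) (x := x)
      (Filter.Eventually.of_forall fun y => f.apply_symm_apply y) (df' _) (df _)
  have h2 := congrArg (fun A => A v) h
  simp only [ContinuousLinearMap.comp_apply, ContinuousLinearMap.id_apply] at h2
  rw [hf, f.apply_symm_apply, h2]

theorem Carries.inv {f : Equiv.Perm E} {S T : Set (E × E)} (hf : Carries f S T)
    (df : f ∈ orientedDiffeo E) : Carries (⇑f⁻¹) T S :=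
  hf.symm (orientedDiffeo.differentiable df) (orientedDiffeo.differentiable_symm df)

/-- The segment from 1 to 1 + B consists of invertible maps by the Neumann series, so the
determinant keeps the sign it has at 1. -/
theorem det_one_add_pos [FiniteDimensional ℝ E] {B : E →L[ℝ] E} (hB : ‖B‖ < 1) :
    0 < (1 + B).det := by
  have hcont : Continuous fun s : ℝ => (1 + s • B).det :=
    ContinuousLinearMap.continuous_det.comp (by fun_prop)
  have hne : ∀ s ∈ Set.Icc (0 : ℝ) 1, (1 + s • B).det ≠ 0 := by
    intro s hs h0
    have : CompleteSpace E := FiniteDimensional.complete ℝ E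
    have hn : ‖-(s • B)‖ < 1 := by
      rw [norm_neg, norm_smul, Real.norm_of_nonneg hs.1]
      nlinarith [norm_nonneg B, hs.2]
    have hu : IsUnit (1 - -(s • B)) := isUnit_one_sub_of_norm_lt_one hn
    rw [sub_neg_eq_add] at hu
    obtain ⟨C, hC⟩ := hu.exists_right_inv
    have := congrArg ContinuousLinearMap.det hC
    rw [ContinuousLinearMap.mul_def, ContinuousLinearMap.det_mul', h0, zero_mul] at this
    simp [ContinuousLinearMap.det] at this
  by_contra hc
  push Not at hc
  have h1 : (1 + (0 : ℝ) • B).det = 1 := by simp [ContinuousLinearMap.det]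
  obtain ⟨s, hs, h⟩ := intermediate_value_Icc' (zero_le_one' ℝ) hcont.continuousOn
    (show (0 : ℝ) ∈ Set.Icc _ _ by simp only [one_smul, h1]; exact ⟨hc, zero_le_one⟩)
  exact hne s hs h

/-- A smooth perturbation of the identity with small derivative is a diffeomorphism. -/
theorem exists_orientedDiffeo_add [FiniteDimensional ℝ E] {g : E → E} (hg : ContDiff ℝ ∞ g)
    (hb : ∀ x, ‖fderiv ℝ g x‖ ≤ 1 / 2) :
    ∃ f ∈ orientedDiffeo E, ∀ x, f x = x + g x := by
  have : CompleteSpace E := FiniteDimensional.complete ℝ E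
  have hgd : Differentiable ℝ g := hg.differentiable (by simp)
  have hlip : LipschitzWith (1 / 2) g := lipschitzWith_of_nnnorm_fderiv_le hgd fun x => by
    rw [← NNReal.coe_le_coe]
    simpa using hb x
  -- Lipschitz constant 1/2 < 1 makes the quantitative inverse function theorem apply on the whole
  -- space.
  have happ : ApproximatesLinearOn (fun x => x + g x)
      ((ContinuousLinearEquiv.refl ℝ E : E ≃L[ℝ] E) : E →L[ℝ] E) Set.univ (1 / 2) := by
    rw [ApproximatesLinearOn.approximatesLinearOn_iff_lipschitzOnWith]
    refine LipschitzWith.lipschitzOnWith ?_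
    convert hlip using 1
    ext x
    simp
  have hsub : Subsingleton E ∨ (1 / 2 : NNReal) <
      ‖((ContinuousLinearEquiv.refl ℝ E).symm : E →L[ℝ] E)‖₊⁻¹ := by
    rcases subsingleton_or_nontrivial E with h | h
    · exact Or.inl h
    · right
      have : ‖((ContinuousLinearEquiv.refl ℝ E).symm : E →L[ℝ] E)‖₊ = 1 := by
        rw [← NNReal.coe_inj]
        exact ContinuousLinearMap.norm_id
      rw [this, inv_one]
      exact NNReal.half_lt_self one_ne_zero
  set h := happ.toHomeomorph _ hsub with hh
  have hfun : ∀ x, h x = x + g x := fun x => rfl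
  have hsm : ContDiff ℝ ∞ h := contDiff_id.add hg
  have hfd : ∀ x, HasFDerivAt h (1 + fderiv ℝ g x) x := fun x =>
    (hasFDerivAt_id x).add (hgd x).hasFDerivAt
  have hdet : ∀ x, 0 < (1 + fderiv ℝ g x).det := fun x =>
    det_one_add_pos (lt_of_le_of_lt (hb x) (by norm_num))
  refine ⟨h.toEquiv, ⟨hsm, ?_, fun x => ?_⟩, hfun⟩
  · refine h.contDiff_symm (f₀' := fun x =>
      (1 + fderiv ℝ g x).toContinuousLinearEquivOfDetNeZero (hdet x).ne') (fun x => ?_) hsm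
    simpa using hfd x
  · have := (hfd x).fderiv
    exact this ▸ hdet x

/-- A map fixing the origin, with derivative close to the identity there, coincides near the origin
with a perturbation of the identity that is small and has small support. -/
theorem exists_smooth_cutoff_perturbation (E : Type*) [NormedAddCommGroup E]
    [InnerProductSpace ℝ E] [FiniteDimensional ℝ E] :
    ∃ c₀ : ℝ, 0 < c₀ ∧ ∀ T : E → E, ContDiff ℝ ∞ T → T 0 = 0 → ‖fderiv ℝ T 0 - 1‖ ≤ c₀ →
      ∀ η > 0, ∃ χ : E → ℝ, (∀ x, η ≤ ‖x‖ → χ x = 0) ∧ (∀ᶠ x in nhds 0, χ x = 1) ∧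
        ContDiff ℝ ∞ (fun x => χ x • (T x - x)) ∧
        ∀ x, ‖fderiv ℝ (fun x => χ x • (T x - x)) x‖ ≤ 1 / 2 := by
  let β : ContDiffBump (0 : E) := ⟨1 / 2, 1, by norm_num, by norm_num⟩
  have hβs : ContDiff ℝ ∞ β := β.contDiff
  obtain ⟨M, hM⟩ := (β.hasCompactSupport.fderiv (𝕜 := ℝ)).exists_bound_of_continuous
    (hβs.continuous_fderiv (by simp))
  have hM0 : 0 ≤ M := (norm_nonneg _).trans (hM 0)
  -- `M` bounds the derivative of the bump at unit scale. At scale ε the bound is M/ε, while ‖T x -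
  -- x‖ ≤ 2c₀ε there, so the product rule gives 2c₀(1 + M) = 1/2 for every ε. Hence c₀ does not
  -- depend on η.
  refine ⟨1 / (4 * (1 + M)), by positivity, fun T hT hT0 hT1 η hη => ?_⟩
  have hcont : Continuous fun x => ‖fderiv ℝ T x - 1‖ :=
    ((hT.continuous_fderiv (by simp)).sub continuous_const).norm
  have hnear : ∀ᶠ x in nhds (0 : E), ‖fderiv ℝ T x - 1‖ < 2 * (1 / (4 * (1 + M))) := by
    refine hcont.continuousAt.eventually (gt_mem_nhds (lt_of_le_of_lt hT1 ?_))
    have : 0 < 1 / (4 * (1 + M)) := by positivity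
    linarith
  obtain ⟨r, hr, hrb⟩ := Metric.eventually_nhds_iff_ball.1 hnear
  set ε := min η r with hε
  have hε0 : 0 < ε := lt_min hη hr
  have hTd : Differentiable ℝ T := hT.differentiable (by simp)
  have hder : ∀ x, HasFDerivAt (fun x => T x - x) (fderiv ℝ T x - 1) x := fun x =>
    (hTd x).hasFDerivAt.sub (hasFDerivAt_id x)
  have hsmall : ∀ x ∈ Metric.ball (0 : E) ε, ‖T x - x‖ ≤ 2 * (1 / (4 * (1 + M))) * ‖x‖ := by
    intro x hx
    have := (convex_ball (0 : E) ε).norm_image_sub_le_of_norm_hasFDerivWithin_le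
      (fun y _ => (hder y).hasFDerivWithinAt)
      (fun y hy => (hrb y (Metric.ball_subset_ball (min_le_right _ _) hy)).le)
      (Metric.mem_ball_self hε0) hx
    simpa [hT0] using this
  have hχs : ContDiff ℝ ∞ fun x : E => β (ε⁻¹ • x) := hβs.comp (contDiff_const_smul _)
  have hχ0 : ∀ x : E, ε ≤ ‖x‖ → β (ε⁻¹ • x) = 0 := fun x hx => by
    refine β.zero_of_le_dist ?_
    rw [dist_zero_right, norm_smul, norm_inv, Real.norm_of_nonneg hε0.le, ← div_eq_inv_mul,
      le_div_iff₀ hε0]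
    change 1 * ε ≤ ‖x‖
    rwa [one_mul]
  have hχd : ∀ x : E, HasFDerivAt (fun x : E => β (ε⁻¹ • x)) (ε⁻¹ • fderiv ℝ β (ε⁻¹ • x)) x := by
    intro x
    have h1 : HasFDerivAt (fun x : E => ε⁻¹ • x) (ε⁻¹ • (1 : E →L[ℝ] E)) x :=
      (hasFDerivAt_id x).const_smul _
    have h2 := (hβs.differentiable (by simp) (ε⁻¹ • x)).hasFDerivAt.comp x h1
    refine h2.congr_fderiv ?_
    ext v
    simp
  have hprod : ContDiff ℝ ∞ fun x => β (ε⁻¹ • x) • (T x - x) := hχs.smul (hT.sub contDiff_id)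
  refine ⟨fun x => β (ε⁻¹ • x), fun x hx => hχ0 x ((min_le_left _ _).trans hx), ?_, hprod,
    fun x => ?_⟩
  · filter_upwards [Metric.ball_mem_nhds (0 : E) (half_pos hε0)] with x hx
    refine β.one_of_mem_closedBall ?_
    rw [mem_closedBall_zero_iff, norm_smul, norm_inv, Real.norm_of_nonneg hε0.le,
      ← div_eq_inv_mul, div_le_iff₀ hε0]
    rw [mem_ball_zero_iff] at hx
    change ‖x‖ ≤ 1 / 2 * ε
    linarith
  · rcases lt_or_ge ‖x‖ ε with hx | hx
    · have hxb : x ∈ Metric.ball (0 : E) ε := by simpa using hx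
      have hd := (hχd x).smul (hder x)
      rw [show (fun x => β (ε⁻¹ • x) • (T x - x)) =
        ((fun x : E => β (ε⁻¹ • x)) • fun x => T x - x) from rfl, hd.fderiv]
      refine (norm_add_le _ _).trans ?_
      have e1 : ‖β (ε⁻¹ • x) • (fderiv ℝ T x - 1)‖ ≤ 2 * (1 / (4 * (1 + M))) := by
        rw [norm_smul, Real.norm_of_nonneg β.nonneg]
        have h1 := (hrb x (Metric.ball_subset_ball (min_le_right _ _) hxb)).le
        have h2 : β (ε⁻¹ • x) ≤ 1 := β.le_one
        have h3 : (0 : ℝ) ≤ β (ε⁻¹ • x) := β.nonneg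
        nlinarith [norm_nonneg (fderiv ℝ T x - 1)]
      have e2 : ‖(ε⁻¹ • fderiv ℝ β (ε⁻¹ • x)).smulRight (T x - x)‖ ≤
          M * (2 * (1 / (4 * (1 + M)))) := by
        rw [ContinuousLinearMap.norm_smulRight_apply, norm_smul, norm_inv,
          Real.norm_of_nonneg hε0.le]
        have h1 := hM (ε⁻¹ • x)
        have h2 := hsmall x hxb
        have h3 : ‖T x - x‖ ≤ 2 * (1 / (4 * (1 + M))) * ε :=
          h2.trans (mul_le_mul_of_nonneg_left hx.le (by positivity))
        calc ε⁻¹ * ‖fderiv ℝ β (ε⁻¹ • x)‖ * ‖T x - x‖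
            ≤ ε⁻¹ * M * (2 * (1 / (4 * (1 + M))) * ε) := by gcongr
          _ = M * (2 * (1 / (4 * (1 + M)))) := by field_simp
      refine (add_le_add e1 e2).trans (le_of_eq ?_)
      field_simp
      norm_num
    · have hx0 : fderiv ℝ (fun x => β (ε⁻¹ • x) • (T x - x)) x = 0 := by
        -- The cutoff is nonnegative and vanishes at x, so x is a minimum of it.
        have h1 : fderiv ℝ (fun x : E => β (ε⁻¹ • x)) x = 0 := by
          refine IsLocalMin.fderiv_eq_zero (Filter.Eventually.of_forall fun y => ?_)
          simp only [hχ0 x hx]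
          exact β.nonneg
        have hd := (hχd x).smul (hder x)
        rw [(hχd x).fderiv] at h1
        rw [show (fun x => β (ε⁻¹ • x) • (T x - x)) =
          ((fun x : E => β (ε⁻¹ • x)) • fun x => T x - x) from rfl, hd.fderiv, h1, hχ0 x hx]
        ext v
        simp
      rw [hx0, norm_zero]
      norm_num

end Diffeomorphisms

/-! ### Diffeomorphisms preserving a straight piece of a knot. -/

section Flat

variable {E : Type*} [NormedAddCommGroup E] [InnerProductSpace ℝ E]

/-- Within the open ball of radius `η`, the tangent vectors in `T` are exactly the positive
multiples of `v` based at the points of the line spanned by `v`. -/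
def IsFlat (T : Set (E × E)) (v : E) (η : ℝ) : Prop :=
  ∀ x w, ‖x‖ < η → ((x, w) ∈ T ↔ (∃ s : ℝ, x = s • v) ∧ ∃ c : ℝ, 0 < c ∧ w = c • v)

theorem orientedDiffeo.fderiv_injective {f : Equiv.Perm E} (hf : f ∈ orientedDiffeo E) (x : E) :
    Function.Injective (fderiv ℝ f x) := by
  have h := fderiv_eq_id_of_leftInverse (f := f) (g := f.symm) (x := x)
      (Filter.Eventually.of_forall fun y => f.symm_apply_apply y)
      (orientedDiffeo.differentiable hf _) (orientedDiffeo.differentiable_symm hf _)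
  intro v w hvw
  have h1 := congrArg (fun A => A v) h
  have h2 := congrArg (fun A => A w) h
  simp only [ContinuousLinearMap.comp_apply, ContinuousLinearMap.id_apply] at h1 h2
  rw [← h1, ← h2, hvw]

/-- On the line spanned by v, f acts as s ↦ s + γ(s) with |γ'| ≤ 1/2. This is an increasing
bijection, so it preserves both the line and the positive direction along it. Outside the ball of
radius η' nothing moves, and η' < η makes f the identity near every point where flatness gives no
information. -/
theorem carries_of_isFlat {f : Equiv.Perm E} (hf : f ∈ orientedDiffeo E) {g : E → E}
    (hg : ContDiff ℝ ∞ g) (hb : ∀ x, ‖fderiv ℝ g x‖ ≤ 1 / 2) (hfg : ∀ x, f x = x + g x)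
    {T : Set (E × E)} {v : E} {η η' : ℝ} (hv : v ≠ 0) (hη : η' < η) (hT : IsFlat T v η)
    (h0 : ∀ x, η' ≤ ‖x‖ → g x = 0) (hline : ∀ s : ℝ, ∃ s' : ℝ, g (s • v) = s' • v) :
    Carries f T T := by
  have hgd : Differentiable ℝ g := hg.differentiable (by simp)
  have hv2 : (0 : ℝ) < ‖v‖ ^ 2 := by positivity
  -- `hline` gives a coefficient for each s without any regularity; the inner product gives one that
  -- is differentiable in s.
  set γ : ℝ → ℝ := fun s => inner ℝ v (g (s • v)) / ‖v‖ ^ 2 with hγ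
  have hγg : ∀ s, g (s • v) = γ s • v := fun s => by
    obtain ⟨s', hs'⟩ := hline s
    rw [hγ]
    simp only [hs', inner_smul_right, real_inner_self_eq_norm_sq]
    rw [mul_div_cancel_right₀ _ hv2.ne']
  have hfv : ∀ s, f (s • v) = (s + γ s) • v := fun s => by rw [hfg, hγg, add_smul]
  have hcurve : ∀ s : ℝ, HasDerivAt (fun s : ℝ => g (s • v)) (fderiv ℝ g (s • v) v) s := by
    intro s
    have h1 : HasDerivAt (fun s : ℝ => s • v) ((1 : ℝ) • v) s := (hasDerivAt_id s).smul_const v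
    rw [one_smul] at h1
    exact (hgd (s • v)).hasFDerivAt.comp_hasDerivAt s h1
  have hγd : ∀ s : ℝ, HasDerivAt γ (inner ℝ v (fderiv ℝ g (s • v) v) / ‖v‖ ^ 2) s := fun s =>
    ((innerSL ℝ v).hasFDerivAt.comp_hasDerivAt s (hcurve s)).div_const _
  have hDg : ∀ s : ℝ, fderiv ℝ g (s • v) v = deriv γ s • v := fun s => by
    have h1 : HasDerivAt (fun s : ℝ => g (s • v)) (deriv γ s • v) s := by
      have h2 := ((hγd s).differentiableAt.hasDerivAt).smul_const v
      exact h2.congr_of_eventuallyEq (Filter.Eventually.of_forall hγg)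
    exact (hcurve s).unique h1
  have hγb : ∀ s, |deriv γ s| ≤ 1 / 2 := fun s => by
    have h1 := (fderiv ℝ g (s • v)).le_of_opNorm_le (hb _) v
    rw [hDg, norm_smul, Real.norm_eq_abs] at h1
    exact le_of_mul_le_mul_right h1 (norm_pos_iff.2 hv)
  have hDf : ∀ x w, fderiv ℝ f x w = w + fderiv ℝ g x w := fun x w => by
    have h1 : HasFDerivAt f (ContinuousLinearMap.id ℝ E + fderiv ℝ g x) x :=
      ((hasFDerivAt_id x).add (hgd x).hasFDerivAt).congr_of_eventuallyEq
        (Filter.Eventually.of_forall hfg)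
    rw [h1.fderiv]
    rfl
  have hDfv : ∀ s : ℝ, fderiv ℝ f (s • v) v = (1 + deriv γ s) • v := fun s => by
    rw [hDf, hDg, add_smul, one_smul]
  have hsurj : Function.Surjective fun s => s + γ s := by
    have hcont : Continuous fun s => s + γ s :=
      continuous_id.add (continuous_iff_continuousAt.2 fun s => (hγd s).continuousAt)
    have hγ0 : ∀ s, η' / ‖v‖ ≤ |s| → γ s = 0 := fun s hs => by
      have : g (s • v) = 0 := h0 _ (by
        rw [norm_smul, Real.norm_eq_abs]
        exact (div_le_iff₀ (norm_pos_iff.2 hv)).1 hs)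
      simp [hγ, this]
    refine hcont.surjective ?_ ?_
    · refine Filter.tendsto_id.congr' ?_
      filter_upwards [Filter.eventually_ge_atTop (η' / ‖v‖)] with s hs
      simp [hγ0 s (hs.trans (le_abs_self s))]
    · refine Filter.tendsto_id.congr' ?_
      filter_upwards [Filter.eventually_le_atBot (-(η' / ‖v‖))] with s hs
      simp [hγ0 s ((le_neg_of_le_neg hs).trans (neg_le_abs s))]
  intro x w
  rcases le_or_gt η ‖x‖ with hx | hx
  · have hev : f =ᶠ[nhds x] id := by
      have : ∀ᶠ y in nhds x, η' < ‖y‖ :=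
        continuous_norm.continuousAt.eventually (lt_mem_nhds (hη.trans_le hx))
      filter_upwards [this] with y hy
      simp [hfg, h0 y hy.le]
    rw [hev.fderiv_eq, hev.eq_of_nhds]
    simp
  -- Points outside the ball are fixed, so by injectivity no inner point lands on one of them.
  · have hfx : ‖f x‖ < η := by
      by_contra hc
      push Not at hc
      have h1 : f (f x) = f x := by
        rw [hfg (f x), h0 _ (hη.le.trans hc), add_zero]
      rw [f.injective h1] at hc
      linarith
    rw [hT x w hx, hT _ _ hfx]
    have key : (∃ s : ℝ, x = s • v) ↔ ∃ s : ℝ, f x = s • v := by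
      constructor
      · rintro ⟨s, rfl⟩
        exact ⟨_, hfv s⟩
      · rintro ⟨s, hs⟩
        obtain ⟨s', hs'⟩ := hsurj s
        refine ⟨s', f.injective ?_⟩
        rw [hs, hfv]
        exact congrArg (· • v) hs'.symm
    rw [← key]
    refine and_congr_right ?_
    rintro ⟨s, rfl⟩
    have hpos : 0 < 1 + deriv γ s := by linarith [neg_le_of_abs_le (hγb s)]
    constructor
    · rintro ⟨c, hc, rfl⟩
      exact ⟨c * (1 + deriv γ s), mul_pos hc hpos, by rw [map_smul, hDfv, smul_smul]⟩
    · rintro ⟨c, hc, h⟩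
      refine ⟨c / (1 + deriv γ s), div_pos hc hpos,
        orientedDiffeo.fderiv_injective hf (s • v) ?_⟩
      rw [h, map_smul, hDfv, smul_smul, div_mul_cancel₀ _ hpos.ne']

variable [FiniteDimensional ℝ E]

variable (E) in
/-- A map near the identity that preserves a line is, as a germ, realized by a diffeomorphism
preserving a given flat set of tangent vectors. -/
theorem exists_carries_of_germ :
    ∃ c₀ : ℝ, 0 < c₀ ∧ ∀ F : E → E, ContDiff ℝ ∞ F → F 0 = 0 → ‖fderiv ℝ F 0 - 1‖ ≤ c₀ →
      ∀ (T : Set (E × E)) (v : E) (η ρ : ℝ), v ≠ 0 → 0 < η → 0 < ρ → IsFlat T v η →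
      (∀ s : ℝ, ‖s • v‖ < ρ → ∃ s' : ℝ, F (s • v) = s' • v) →
      ∃ f ∈ orientedDiffeo E, Carries f T T ∧ ∀ᶠ x in nhds 0, f x = F x := by
  obtain ⟨c₀, hc₀, H⟩ := exists_smooth_cutoff_perturbation E
  refine ⟨c₀, hc₀, fun F hF hF0 hF1 T v η ρ hv hη hρ hT hline => ?_⟩
  -- The support must stay well inside the flat ball and inside the region where `F` preserves the
  -- line.
  obtain ⟨χ, hχ0, hχ1, hg, hb⟩ := H F hF hF0 hF1 (min (η / 2) ρ) (lt_min (half_pos hη) hρ)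
  obtain ⟨f, hf, hfg⟩ := exists_orientedDiffeo_add hg hb
  refine ⟨f, hf, carries_of_isFlat hf hg hb hfg hv (half_lt_self hη) hT ?_ ?_, ?_⟩
  · intro x hx
    rw [hχ0 x ((min_le_left _ _).trans hx), zero_smul]
  · intro s
    rcases lt_or_ge ‖s • v‖ ρ with h | h
    · obtain ⟨s', hs'⟩ := hline s h
      exact ⟨χ (s • v) * (s' - s), by rw [hs', ← sub_smul, smul_smul]⟩
    · exact ⟨0, by rw [hχ0 _ ((min_le_right _ _).trans h), zero_smul, zero_smul]⟩
  · filter_upwards [hχ1] with x hx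
    rw [hfg, hx, one_smul, add_sub_cancel]

/-- Points can be pushed along a flat set of tangent vectors. -/
theorem IsFlat.exists_push {T : Set (E × E)} {v : E} {η : ℝ} (hv : v ≠ 0) (hη : 0 < η)
    (hT : IsFlat T v η) :
    ∃ δ > 0, ∀ s : ℝ, |s| < δ → ∃ f ∈ orientedDiffeo E, Carries f T T ∧ f 0 = s • v := by
  let β : ContDiffBump (0 : E) := ⟨η / 4, η / 2, by linarith, by linarith⟩
  have hβs : ContDiff ℝ ∞ β := β.contDiff
  obtain ⟨M, hM⟩ := (β.hasCompactSupport.fderiv (𝕜 := ℝ)).exists_bound_of_continuous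
    (hβs.continuous_fderiv (by simp))
  have hM0 : 0 ≤ M := (norm_nonneg _).trans (hM 0)
  refine ⟨1 / (2 * (M + 1) * (‖v‖ + 1)), by positivity, fun s hs => ?_⟩
  have hg : ContDiff ℝ ∞ fun x => β x • (s • v) := hβs.smul contDiff_const
  have hb : ∀ x, ‖fderiv ℝ (fun x => β x • (s • v)) x‖ ≤ 1 / 2 := by
    intro x
    have h1 := ((hβs.differentiable (by simp) x).hasFDerivAt.smul_const (s • v)).fderiv
    rw [h1, ContinuousLinearMap.norm_smulRight_apply, norm_smul, Real.norm_eq_abs]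
    have h2 := hM x
    rw [lt_div_iff₀ (by positivity)] at hs
    have h3 : ‖fderiv ℝ β x‖ * (|s| * ‖v‖) ≤ (M + 1) * (|s| * (‖v‖ + 1)) := by
      gcongr <;> linarith
    nlinarith
  obtain ⟨f, hf, hfg⟩ := exists_orientedDiffeo_add hg hb
  refine ⟨f, hf, carries_of_isFlat hf hg hb hfg hv (half_lt_self hη) hT ?_ ?_, ?_⟩
  · intro x hx
    rw [β.zero_of_le_dist (by simpa [dist_zero_right] using hx), zero_smul]
  · exact fun r => ⟨β (r • v) * s, smul_smul _ _ _⟩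
  · rw [hfg, zero_add, β.one_of_mem_closedBall (Metric.mem_closedBall_self β.rIn_pos.le), one_smul]

end Flat

/-! ### The oriented knot as a set of tangent vectors. -/

section Knots

namespace OrientedKnot

/-- The positive multiples of the velocity vectors of the knot. -/
def tangents (k : OrientedKnot) : Set (E3 × E3) :=
  {p | ∃ t c : ℝ, 0 < c ∧ p.1 = k.toFun t ∧ p.2 = c • deriv k.toFun t}

theorem differentiable (k : OrientedKnot) : Differentiable ℝ k.toFun :=
  k.smooth.differentiable (by simp)

theorem toFun_add_int (k : OrientedKnot) (t : ℝ) (n : ℤ) : k.toFun (t + n) = k.toFun t := by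
  simpa using k.periodic.int_mul n t

theorem deriv_add_int (k : OrientedKnot) (t : ℝ) (n : ℤ) :
    deriv k.toFun (t + n) = deriv k.toFun t := by
  rw [← deriv_comp_add_const]
  exact congrArg (deriv · t) (funext fun s => k.toFun_add_int s n)

theorem mem_tangents (k : OrientedKnot) (t : ℝ) : (k.toFun t, deriv k.toFun t) ∈ k.tangents :=
  ⟨t, 1, one_pos, rfl, (one_smul _ _).symm⟩

/-- Base points of the tangent set recover the knot, so `Carries` also transports the ranges. -/
theorem exists_mem_tangents_iff (k : OrientedKnot) (x : E3) :
    (∃ v, (x, v) ∈ k.tangents) ↔ x ∈ Set.range k.toFun := by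
  constructor
  · rintro ⟨v, t, c, -, h, -⟩
    exact ⟨t, h.symm⟩
  · rintro ⟨t, rfl⟩
    exact ⟨_, k.mem_tangents t⟩

/-- Points of a knot near `k t₀` have parameters near `t₀`. -/
theorem eventually_parameter_near (k : OrientedKnot) (t₀ : ℝ) {δ : ℝ} (hδ : 0 < δ) :
    ∀ᶠ x in nhds (k.toFun t₀), ∀ t, k.toFun t = x → ∃ n : ℤ, |t + n - t₀| < δ := by
  -- Parameters at distance at least δ from t₀ modulo 1 trace a compact arc that misses `k t₀`.
  have hC : IsCompact (k.toFun '' Set.Icc (t₀ + δ) (t₀ + 1 - δ)) :=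
    isCompact_Icc.image k.smooth.continuous
  have hmem : k.toFun t₀ ∉ k.toFun '' Set.Icc (t₀ + δ) (t₀ + 1 - δ) := by
    rintro ⟨t, ⟨h1, h2⟩, h⟩
    obtain ⟨n, hn⟩ := k.injective _ _ h
    have e1 : (n : ℝ) < 0 := by linarith
    have e2 : (-1 : ℝ) < n := by linarith
    have e3 : n < 0 := by exact_mod_cast e1
    have e4 : -1 < n := by exact_mod_cast e2
    omega
  filter_upwards [hC.isClosed.isOpen_compl.mem_nhds hmem]
  rintro x hx t rfl
  refine ⟨-⌊t - t₀ + 1 / 2⌋, ?_⟩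
  have f1 := Int.floor_le (t - t₀ + 1 / 2)
  have f2 := Int.lt_floor_add_one (t - t₀ + 1 / 2)
  set n := ⌊t - t₀ + 1 / 2⌋
  have hk : k.toFun (t + (-n : ℤ)) = k.toFun t := k.toFun_add_int t (-n)
  push_cast at hk ⊢
  by_contra hc
  push Not at hc
  rcases le_abs.1 hc with h | h
  · exact hx ⟨t + -n, ⟨by linarith, by linarith⟩, hk⟩
  · refine hx ⟨t + -n + (1 : ℤ), ⟨by push_cast; linarith, by push_cast; linarith⟩, ?_⟩
    rw [toFun_add_int, hk]

end OrientedKnot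

end Knots

/-! ### Straightening a knot, moving along it, and the end of an isotopy. -/

section Motions

theorem addLeft_mem_orientedDiffeo {E : Type*} [NormedAddCommGroup E] [NormedSpace ℝ E] (a : E) :
    Equiv.addLeft a ∈ orientedDiffeo E := by
  refine ⟨contDiff_const.add contDiff_id, contDiff_const.add contDiff_id, fun x => ?_⟩
  have : HasFDerivAt (⇑(Equiv.addLeft a)) (ContinuousLinearMap.id ℝ E) x :=
    (hasFDerivAt_id x).const_add a
  rw [this.fderiv]
  simp [ContinuousLinearMap.det]

namespace OrientedKnot

/-- A knot is straightened near each of its points by a diffeomorphism. -/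
theorem exists_straightening (k : OrientedKnot) (t₀ : ℝ) :
    ∃ f ∈ orientedDiffeo E3, f 0 = k.toFun t₀ ∧ ∃ (T : Set (E3 × E3)) (η : ℝ), 0 < η ∧
      IsFlat T (deriv k.toFun t₀) η ∧ Carries f T k.tangents := by
  set v := deriv k.toFun t₀ with hvdef
  have hv : v ≠ 0 := k.immersion t₀
  have hv2 : (0 : ℝ) < ‖v‖ ^ 2 := by positivity
  set l : E3 →L[ℝ] ℝ := (‖v‖ ^ 2)⁻¹ • innerSL ℝ v with hl
  have hlv : ∀ s : ℝ, l (s • v) = s := fun s => by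
    simp only [hl, smul_apply, innerSL_apply_apply, inner_smul_right,
      real_inner_self_eq_norm_sq, smul_eq_mul]
    field_simp
  -- This model map sends s • v to k(t₀ + s) - k(t₀) and is the identity on the kernel of l. Its
  -- derivative at 0 is the identity, so its germ extends to a diffeomorphism.
  have hF : ContDiff ℝ ∞ fun x : E3 => k.toFun (t₀ + l x) - k.toFun t₀ + (x - l x • v) := by
    have h1 : ContDiff ℝ ∞ fun x : E3 => k.toFun (t₀ + l x) :=
      k.smooth.comp (contDiff_const.add l.contDiff)
    exact (h1.sub contDiff_const).add (contDiff_id.sub (l.contDiff.smul contDiff_const))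
  have hF1 : HasFDerivAt (fun x : E3 => k.toFun (t₀ + l x) - k.toFun t₀ + (x - l x • v))
      (1 : E3 →L[ℝ] E3) 0 := by
    have h0 : HasDerivAt k.toFun v (t₀ + l 0) := by
      rw [map_zero, add_zero]
      exact (k.differentiable t₀).hasDerivAt
    have h1 : HasFDerivAt (fun x : E3 => k.toFun (t₀ + l x)) (l.smulRight v) 0 := by
      refine (h0.hasFDerivAt.comp (0 : E3) (l.hasFDerivAt.const_add t₀)).congr_fderiv ?_
      ext w
      simp
    have h2 := (h1.sub_const (k.toFun t₀)).add ((hasFDerivAt_id (𝕜 := ℝ) (0 : E3)).sub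
      (l.hasFDerivAt.smul_const v))
    refine h2.congr_fderiv ?_
    ext w
    simp
  obtain ⟨c₀, hc₀, H⟩ := exists_smooth_cutoff_perturbation E3
  obtain ⟨χ, -, hχ1, hg, hb⟩ := H _ hF (by simp) (by rw [hF1.fderiv]; simpa using hc₀.le) 1 one_pos
  obtain ⟨f₀, hf₀, hf₀g⟩ := exists_orientedDiffeo_add hg hb
  set f : Equiv.Perm E3 := Equiv.addLeft (k.toFun t₀) * f₀ with hfdef
  have hf : f ∈ orientedDiffeo E3 := mul_mem (addLeft_mem_orientedDiffeo _) hf₀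
  have hfs : ∀ᶠ s : ℝ in nhds 0, f (s • v) = k.toFun (t₀ + s) := by
    have hc : Filter.Tendsto (fun s : ℝ => s • v) (nhds 0) (nhds 0) := by
      have : Continuous fun s : ℝ => s • v := by fun_prop
      simpa using this.tendsto 0
    filter_upwards [hc.eventually hχ1] with s hs
    change k.toFun t₀ + f₀ (s • v) = _
    rw [hf₀g, hs, hlv]
    simp
  obtain ⟨δ, hδ, hfδ⟩ := Metric.eventually_nhds_iff_ball.1 hfs
  have hf0 : f 0 = k.toFun t₀ := by simpa using hfs.self_of_nhds
  have hDf : ∀ s ∈ Metric.ball (0 : ℝ) δ, fderiv ℝ f (s • v) v = deriv k.toFun (t₀ + s) := by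
    intro s hs
    have h1 : HasDerivAt (fun s : ℝ => f (s • v)) (fderiv ℝ f (s • v) v) s := by
      have h1 : HasDerivAt (fun s : ℝ => s • v) ((1 : ℝ) • v) s := (hasDerivAt_id s).smul_const v
      rw [one_smul] at h1
      exact (orientedDiffeo.differentiable hf (s • v)).hasFDerivAt.comp_hasDerivAt s h1
    have h2 : HasDerivAt (fun s : ℝ => f (s • v)) (deriv k.toFun (t₀ + s)) s := by
      have h3 : HasDerivAt (fun s => k.toFun (t₀ + s)) (deriv k.toFun (t₀ + s)) s := by
        simpa using (k.differentiable (t₀ + s)).hasDerivAt.comp_const_add t₀ s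
      refine h3.congr_of_eventuallyEq ?_
      filter_upwards [Metric.isOpen_ball.mem_nhds hs] with r hr using hfδ r hr
    exact h1.unique h2
  have hloc := k.eventually_parameter_near t₀ hδ
  rw [← hf0] at hloc
  have hloc' := (orientedDiffeo.differentiable hf).continuous.continuousAt.eventually hloc
  obtain ⟨η, hη, hηf⟩ := Metric.eventually_nhds_iff_ball.1 hloc'
  -- T is the pullback of the tangent set, so it is carried by definition. The radius ensures that f
  -- x, if on the knot, has a parameter within δ of t₀, and that x = s • v forces |s| < δ.
  refine ⟨f, hf, hf0, {p | (f p.1, fderiv ℝ f p.1 p.2) ∈ k.tangents}, min η (δ * ‖v‖),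
    lt_min hη (mul_pos hδ (norm_pos_iff.2 hv)), ?_, fun x w => Iff.rfl⟩
  intro x w hx
  have hxη : x ∈ Metric.ball (0 : E3) η := by simpa using hx.trans_le (min_le_left _ _)
  have hxδ := hx.trans_le (min_le_right _ _)
  constructor
  · rintro ⟨t, c, hc, h1, h2⟩
    simp only at h1 h2
    obtain ⟨n, hn⟩ := hηf x hxη t h1.symm
    set s := t + n - t₀ with hs
    have hsb : s ∈ Metric.ball (0 : ℝ) δ := by simpa using hn
    have hts : t₀ + s = t + n := by rw [hs]; ring
    have hx' : x = s • v := f.injective (by rw [h1, hfδ s hsb, hts, toFun_add_int])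
    refine ⟨⟨s, hx'⟩, c, hc, orientedDiffeo.fderiv_injective hf x ?_⟩
    rw [h2, map_smul, hx', hDf s hsb, hts, deriv_add_int]
  · rintro ⟨⟨s, rfl⟩, c, hc, rfl⟩
    have hsb : s ∈ Metric.ball (0 : ℝ) δ := by
      rw [norm_smul] at hxδ
      simpa using lt_of_mul_lt_mul_right hxδ (norm_nonneg v)
    exact ⟨t₀ + s, c, hc, hfδ s hsb, by simp only [map_smul, hDf s hsb]⟩

/-- Points of a knot near a given one are reached from it by diffeomorphisms preserving the
oriented knot. -/
theorem eventually_exists_carries (k : OrientedKnot) (t₀ : ℝ) :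
    ∀ᶠ t in nhds t₀, ∃ f ∈ orientedDiffeo E3, Carries f k.tangents k.tangents ∧
      f (k.toFun t₀) = k.toFun t := by
  obtain ⟨f, hf, hf0, T, η, hη, hT, hfT⟩ := k.exists_straightening t₀
  have hv := k.immersion t₀
  obtain ⟨δ, hδ, H⟩ := hT.exists_push hv hη
  have hfinv := hfT.inv hf
  have hc : ContinuousAt (fun t => f.symm (k.toFun t)) t₀ :=
    ((orientedDiffeo.contDiff_symm hf).continuous.comp k.smooth.continuous).continuousAt
  have h0 : f.symm (k.toFun t₀) = 0 := by rw [← hf0, f.symm_apply_apply]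
  have hball : ∀ᶠ t in nhds t₀, ‖f.symm (k.toFun t)‖ < min η (δ * ‖deriv k.toFun t₀‖) := by
    refine hc.norm.eventually (gt_mem_nhds ?_)
    change ‖f.symm (k.toFun t₀)‖ < _
    rw [h0, norm_zero]
    exact lt_min hη (mul_pos hδ (norm_pos_iff.2 hv))
  filter_upwards [hball] with t ht
  obtain ⟨⟨s, hs⟩, -⟩ := (hT _ _ (ht.trans_le (min_le_left _ _))).1
    ((hfinv _ _).1 (k.mem_tangents t))
  change f.symm (k.toFun t) = _ at hs
  have hsδ : |s| < δ := by
    have h1 := ht.trans_le (min_le_right _ _)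
    rw [hs, norm_smul] at h1
    exact lt_of_mul_lt_mul_right h1 (norm_nonneg _)
  obtain ⟨P, hP, hPT, hP0⟩ := H s hsδ
  -- The push along the straight line, conjugated by the straightening.
  refine ⟨f * P * f⁻¹, mul_mem (mul_mem hf hP) (inv_mem hf),
    (hfT.mul hPT hf hP).mul hfinv (mul_mem hf hP) (inv_mem hf), ?_⟩
  change f (P (f.symm (k.toFun t₀))) = _
  rw [h0, hP0, ← hs, f.apply_symm_apply]

/-- Any two points of a knot are interchangeable by diffeomorphisms preserving the oriented knot. -/
theorem exists_carries_point (k : OrientedKnot) (s t : ℝ) :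
    ∃ f ∈ orientedDiffeo E3, Carries f k.tangents k.tangents ∧ f (k.toFun s) = k.toFun t := by
  -- Reachable parameters form an open set, and so do unreachable ones, since nearby points can be
  -- exchanged; ℝ is connected.
  set A : Set ℝ := {t | ∃ f ∈ orientedDiffeo E3, Carries f k.tangents k.tangents ∧
    f (k.toFun s) = k.toFun t} with hA
  have hopen : IsOpen A := by
    rw [isOpen_iff_mem_nhds]
    rintro t ⟨f, hf, hfk, hft⟩
    filter_upwards [k.eventually_exists_carries t]
    rintro r ⟨g, hg, hgk, hgr⟩
    exact ⟨g * f, mul_mem hg hf, hgk.mul hfk hg hf, by rw [Equiv.Perm.mul_apply, hft, hgr]⟩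
  have hclosed : IsClosed A := by
    rw [← isOpen_compl_iff, isOpen_iff_mem_nhds]
    intro t ht
    filter_upwards [k.eventually_exists_carries t]
    rintro r ⟨g, hg, hgk, hgr⟩ ⟨f, hf, hfk, hfr⟩
    refine ht ⟨g⁻¹ * f, mul_mem (inv_mem hg) hf, (hgk.inv hg).mul hfk (inv_mem hg) hf, ?_⟩
    rw [Equiv.Perm.mul_apply, hfr, ← hgr]
    exact g.symm_apply_apply _
  have hne : A.Nonempty := ⟨s, 1, one_mem _, fun x v => by
    have : fderiv ℝ (⇑(1 : Equiv.Perm E3)) x = ContinuousLinearMap.id ℝ E3 := fderiv_id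
    rw [this]
    rfl, rfl⟩
  have : t ∈ A := by
    rw [IsClopen.eq_univ ⟨hclosed, hopen⟩ hne]
    trivial
  exact this

/-- An ambient isotopy ends in an orientation-preserving diffeomorphism. -/
theorem Isotopic.exists_carries {K₀ K₁ : OrientedKnot} (h : K₀.Isotopic K₁) :
    ∃ f ∈ orientedDiffeo E3, Carries f K₀.tangents K₁.tangents := by
  obtain ⟨F, hF, hΦ, hF0, h, hh, hh', hh1, hK⟩ := h
  -- At a fixed x the determinant is continuous in t on [0, 1], never zero, and 1 at t = 0.
  have hdet : ∀ x, 0 < (fderiv ℝ (F 1) x).det := by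
    intro x
    have hFd : ∀ t ∈ Set.Icc (0 : ℝ) 1, Differentiable ℝ (F t) := fun t ht => by
      obtain ⟨Φ, hΦt⟩ := hΦ t ht
      rw [← hΦt]
      exact Φ.contDiff.differentiable (by simp)
    have huniq : UniqueDiffOn ℝ (Set.Icc (0 : ℝ) 1 ×ˢ (Set.univ : Set E3)) :=
      (uniqueDiffOn_Icc zero_lt_one).prod uniqueDiffOn_univ
    set G : ℝ → E3 →L[ℝ] E3 := fun t =>
      (fderivWithin ℝ (fun p : ℝ × E3 => F p.1 p.2) (Set.Icc (0 : ℝ) 1 ×ˢ Set.univ) (t, x)).comp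
        (ContinuousLinearMap.inr ℝ ℝ E3) with hG
    have hGF : ∀ t ∈ Set.Icc (0 : ℝ) 1, G t = fderiv ℝ (F t) x := by
      intro t ht
      have h1 : HasFDerivWithinAt (fun p : ℝ × E3 => F p.1 p.2)
          (fderivWithin ℝ (fun p : ℝ × E3 => F p.1 p.2) (Set.Icc (0 : ℝ) 1 ×ˢ Set.univ) (t, x))
          (Set.Icc (0 : ℝ) 1 ×ˢ Set.univ) (t, x) :=
        (hF.differentiableOn (by simp) (t, x) ⟨ht, trivial⟩).hasFDerivWithinAt
      have h2 := h1.comp_hasFDerivAt x (hasFDerivAt_prodMk_right (𝕜 := ℝ) t x)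
        (Filter.Eventually.of_forall fun y => ⟨ht, trivial⟩)
      exact h2.fderiv.symm
    have hGc : ContinuousOn (fun t => (G t).det) (Set.Icc 0 1) := by
      refine ContinuousLinearMap.continuous_det.comp_continuousOn ?_
      have h1 : ContinuousOn (fun t : ℝ => fderivWithin ℝ (fun p : ℝ × E3 => F p.1 p.2)
          (Set.Icc (0 : ℝ) 1 ×ˢ Set.univ) (t, x)) (Set.Icc 0 1) :=
        (hF.continuousOn_fderivWithin huniq (by simp)).comp (by fun_prop)
          fun t ht => ⟨ht, trivial⟩
      exact h1.clm_comp continuousOn_const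
    have hG0 : (G 0).det = 1 := by
      rw [hGF 0 (by simp), show F 0 = id from funext hF0, fderiv_id]
      simp [ContinuousLinearMap.det]
    have hGne : ∀ t ∈ Set.Icc (0 : ℝ) 1, (G t).det ≠ 0 := by
      intro t ht h0
      obtain ⟨Φ, hΦt⟩ := hΦ t ht
      have h1 := fderiv_eq_id_of_leftInverse (f := F t) (g := Φ.symm) (x := x)
        (Filter.Eventually.of_forall fun y => by rw [← hΦt, Φ.symm_apply_apply])
        (hFd t ht x) (Φ.symm.contDiff.differentiable (by simp) _)
      have h2 := congrArg ContinuousLinearMap.det h1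
      rw [ContinuousLinearMap.det_mul', ← hGF t ht, h0, mul_zero] at h2
      simp [ContinuousLinearMap.det] at h2
    rw [← hGF 1 (by simp)]
    by_contra hc
    push Not at hc
    obtain ⟨t, ht, h⟩ := intermediate_value_Icc' (zero_le_one' ℝ) hGc
      (show (0 : ℝ) ∈ Set.Icc _ _ from ⟨hc, by rw [hG0]; exact zero_le_one⟩)
    exact hGne t ht h
  obtain ⟨Φ, hΦ1⟩ := hΦ 1 (by simp)
  have hf : Φ.toEquiv ∈ orientedDiffeo E3 := by
    refine ⟨Φ.contDiff, Φ.symm.contDiff, fun x => ?_⟩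
    have := hdet x
    rw [← hΦ1] at this
    exact this
  have hfK : ∀ t, Φ.toEquiv (K₀.toFun t) = K₁.toFun (h t) := fun t => by
    rw [← hK, ← hΦ1]
    rfl
  have hDf : ∀ t, fderiv ℝ Φ.toEquiv (K₀.toFun t) (deriv K₀.toFun t) =
      deriv h t • deriv K₁.toFun (h t) := by
    intro t
    have h1 := (orientedDiffeo.differentiable hf (K₀.toFun t)).hasFDerivAt.comp_hasDerivAt t
      (K₀.differentiable t).hasDerivAt
    have h2 : HasDerivAt (fun t => K₁.toFun (h t)) (deriv h t • deriv K₁.toFun (h t)) t :=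
      (K₁.differentiable (h t)).hasDerivAt.scomp t (hh.differentiable (by simp) t).hasDerivAt
    exact h1.unique (h2.congr_of_eventuallyEq (Filter.Eventually.of_forall hfK))
  -- h gains n over n periods, hence is unbounded in both directions. Surjectivity is what makes
  -- every tangent vector of `K₁` come from one of `K₀`.
  have hsurj : Function.Surjective h := by
    intro y
    have hint : ∀ n : ℕ, ∀ t, h (t + n) = h t + n := by
      intro n
      induction n with
      | zero => simp
      | succ n ih => intro t; push_cast; rw [← add_assoc, hh1, ih]; ring
    obtain ⟨n, hn⟩ := exists_nat_ge |y - h 0|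
    have e1 := hint n 0
    have e2 := hint n (-n)
    rw [zero_add] at e1
    rw [neg_add_cancel] at e2
    have e3 := abs_le.1 (hn)
    obtain ⟨t, -, ht⟩ := intermediate_value_Icc (f := h) (a := -(n : ℝ)) (b := n)
      (by linarith [Nat.cast_nonneg (α := ℝ) n]) hh.continuous.continuousOn
      (show y ∈ Set.Icc _ _ from ⟨by linarith, by linarith⟩)
    exact ⟨t, ht⟩
  refine ⟨Φ.toEquiv, hf, fun x v => ⟨?_, ?_⟩⟩
  · rintro ⟨t, c, hc, h1, h2⟩
    simp only at h1 h2
    subst h1 h2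
    exact ⟨h t, c * deriv h t, mul_pos hc (hh' t), hfK t, by
      simp only [map_smul]; rw [hDf, smul_smul]⟩
  · rintro ⟨t', c, hc, h1, h2⟩
    obtain ⟨t, rfl⟩ := hsurj t'
    simp only at h1 h2
    rw [← hfK] at h1
    obtain rfl := Φ.toEquiv.injective h1
    refine ⟨t, c / deriv h t, div_pos hc (hh' t), rfl,
      orientedDiffeo.fderiv_injective hf (K₀.toFun t) ?_⟩
    simp only [map_smul]
    rw [h2, hDf, smul_smul, div_mul_cancel₀ _ (hh' t).ne']

end OrientedKnot

end Motions

/-! ### Derivatives at the origin that can be realized. -/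

section LinearParts

variable {E : Type*} [NormedAddCommGroup E] [InnerProductSpace ℝ E]

/-- `A` is the derivative at the origin of a diffeomorphism that fixes the origin and preserves
the set `T` of tangent vectors. -/
def IsLinearPart (T : Set (E × E)) (A : E →L[ℝ] E) : Prop :=
  ∃ f ∈ orientedDiffeo E, Carries f T T ∧ f 0 = 0 ∧ fderiv ℝ f 0 = A

theorem IsLinearPart.comp {T : Set (E × E)} {A B : E →L[ℝ] E} (hA : IsLinearPart T A)
    (hB : IsLinearPart T B) : IsLinearPart T (A.comp B) := by
  obtain ⟨f, hf, hfT, hf0, rfl⟩ := hA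
  obtain ⟨g, hg, hgT, hg0, rfl⟩ := hB
  refine ⟨f * g, mul_mem hf hg, hfT.mul hgT hf hg, by rw [Equiv.Perm.mul_apply, hg0, hf0], ?_⟩
  have := fderiv_comp (0 : E) (orientedDiffeo.differentiable hf (g 0))
    (orientedDiffeo.differentiable hg 0)
  rw [hg0] at this
  exact this

/-- Left division, B = A⁻¹C, by means of the inverse diffeomorphism. It yields closedness in the
connectedness argument for paths. -/
theorem IsLinearPart.of_comp {T : Set (E × E)} {A B C : E →L[ℝ] E} (hA : IsLinearPart T A)
    (hC : IsLinearPart T C) (h : A.comp B = C) : IsLinearPart T B := by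
  obtain ⟨f, hf, hfT, hf0, rfl⟩ := hA
  have hf0' : f.symm 0 = 0 := by rw [f.symm_apply_eq, hf0]
  have hinv : IsLinearPart T (fderiv ℝ f.symm 0) :=
    ⟨f⁻¹, inv_mem hf, hfT.inv hf, hf0', rfl⟩
  have h1 := fderiv_eq_id_of_leftInverse (f := f) (g := f.symm) (x := 0)
      (Filter.Eventually.of_forall fun y => f.symm_apply_apply y)
      (orientedDiffeo.differentiable hf _) (orientedDiffeo.differentiable_symm hf _)
  rw [hf0] at h1
  have h2 := hinv.comp hC
  rw [← h, ← ContinuousLinearMap.comp_assoc, h1, ContinuousLinearMap.id_comp] at h2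
  exact h2

variable [FiniteDimensional ℝ E]

/-- Paths of invertible linear maps with a common eigenvector consist of linear parts. -/
theorem isLinearPart_of_path {T : Set (E × E)} {v : E} {η : ℝ} (hv : v ≠ 0) (hη : 0 < η)
    (hT : IsFlat T v η) (A : ℝ → E →L[ℝ] E) (hA : Continuous A) (hA0 : A 0 = 1)
    (hdet : ∀ s ∈ Set.Icc (0 : ℝ) 1, (A s).det ≠ 0)
    (hAv : ∀ s ∈ Set.Icc (0 : ℝ) 1, ∃ c : ℝ, A s v = c • v) : IsLinearPart T (A 1) := by
  obtain ⟨c₀, hc₀, H⟩ := exists_carries_of_germ E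
  have hsmall : ∀ B : E →L[ℝ] E, ‖B - 1‖ ≤ c₀ → (∃ c : ℝ, B v = c • v) → IsLinearPart T B := by
    rintro B hB ⟨c, hc⟩
    obtain ⟨f, hf, hfT, hfB⟩ := H B B.contDiff (map_zero B) (by rwa [B.fderiv]) T v η 1 hv hη
      one_pos hT (fun s _ => ⟨s * c, by rw [map_smul, hc, smul_smul]⟩)
    refine ⟨f, hf, hfT, by rw [hfB.self_of_nhds, map_zero], ?_⟩
    rw [Filter.EventuallyEq.fderiv_eq hfB, B.fderiv]
  -- For s near s₀ the quotient of `A s` by `A s₀` is close to 1 and still has v as an eigenvector,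
  -- so it is realized by a germ. Hence being a linear part is locally constant along the path.
  have hloc : ∀ s₀ : unitInterval, ∃ C : E ≃L[ℝ] E, (C : E →L[ℝ] E) = A s₀ ∧
      ∀ᶠ s : unitInterval in nhds s₀, IsLinearPart T ((A s).comp (C.symm : E →L[ℝ] E)) := by
    intro s₀
    set C := (A s₀).toContinuousLinearEquivOfDetNeZero (hdet s₀ s₀.2) with hC
    have hCA : (C : E →L[ℝ] E) = A s₀ := by simp [hC]
    refine ⟨C, hCA, ?_⟩
    have hcont : Continuous fun s : unitInterval =>
        ‖(A s).comp (C.symm : E →L[ℝ] E) - 1‖ :=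
      (((hA.comp continuous_subtype_val).clm_comp continuous_const).sub continuous_const).norm
    have h0 : ‖(A s₀).comp (C.symm : E →L[ℝ] E) - 1‖ < c₀ := by
      rw [← hCA, C.coe_comp_coe_symm]
      simpa [ContinuousLinearMap.one_def] using hc₀
    filter_upwards [hcont.continuousAt.eventually (gt_mem_nhds h0)] with s hs
    refine hsmall _ hs.le ?_
    obtain ⟨c, hc⟩ := hAv s s.2
    obtain ⟨d, hd⟩ := hAv s₀ s₀.2
    rw [← hCA] at hd
    have hd0 : d ≠ 0 := by
      rintro rfl
      rw [zero_smul] at hd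
      exact hv (C.map_eq_zero_iff.1 hd)
    refine ⟨d⁻¹ * c, ?_⟩
    have : C.symm v = d⁻¹ • v := by
      rw [C.symm_apply_eq, map_smul]
      change v = d⁻¹ • (C : E →L[ℝ] E) v
      rw [hd, smul_smul, inv_mul_cancel₀ hd0, one_smul]
    change A s (C.symm v) = _
    rw [this, map_smul, hc, smul_smul]
  have hcomp : ∀ (C : E ≃L[ℝ] E) (B : E →L[ℝ] E),
      (B.comp (C.symm : E →L[ℝ] E)).comp (C : E →L[ℝ] E) = B := fun C B => by
    ext x
    simp
  set S : Set unitInterval := {s | IsLinearPart T (A s)} with hS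
  have hopen : IsOpen S := by
    rw [isOpen_iff_mem_nhds]
    intro s₀ hs₀
    obtain ⟨C, hC, hev⟩ := hloc s₀
    filter_upwards [hev] with s hs
    have := hs.comp (hC ▸ hs₀ : IsLinearPart T (C : E →L[ℝ] E))
    rwa [hcomp] at this
  have hclosed : IsClosed S := by
    rw [← isOpen_compl_iff, isOpen_iff_mem_nhds]
    intro s₀ hs₀
    obtain ⟨C, hC, hev⟩ := hloc s₀
    filter_upwards [hev] with s hs hsS
    exact hs₀ (hC ▸ hs.of_comp hsS (hcomp C (A s)) : IsLinearPart T (A s₀))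
  have h0 : (0 : unitInterval) ∈ S := by
    change IsLinearPart T (A 0)
    rw [hA0]
    exact hsmall 1 (by simpa using hc₀.le) ⟨1, by simp⟩
  have h1 : (1 : unitInterval) ∈ S := by
    rw [IsClopen.eq_univ ⟨hclosed, hopen⟩ ⟨0, h0⟩]
    trivial
  exact h1

end LinearParts

/-! ### Connectedness of the linear maps preserving the axis direction. -/

section Axis

theorem Matrix.det_toEuclideanCLM (M : Matrix (Fin 3) (Fin 3) ℝ) :
    (Matrix.toEuclideanCLM (𝕜 := ℝ) M).det = M.det := by
  rw [ContinuousLinearMap.det, Matrix.coe_toEuclideanCLM_eq_toEuclideanLin]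
  exact (congrArg LinearMap.det (congrFun (congrArg _ (Matrix.toLpLin_eq_toLin 2 2)) M)).trans
    (LinearMap.det_toLin _ _)

theorem axis_ne_zero : axis ≠ 0 := by
  intro h
  have := congrArg (fun x : E3 => x 0) h
  simp [axis] at this

theorem norm_axis : ‖axis‖ = 1 := by simp [axis]

theorem toEuclideanCLM_axis (M : Matrix (Fin 3) (Fin 3) ℝ) (i : Fin 3) :
    Matrix.toEuclideanCLM (𝕜 := ℝ) M axis i = M i 0 := by
  rw [Matrix.ofLp_toEuclideanCLM]
  simp [axis, Matrix.mulVec, dotProduct]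

theorem toEuclideanCLM_axis_eq_smul {M : Matrix (Fin 3) (Fin 3) ℝ} (h1 : M 1 0 = 0)
    (h2 : M 2 0 = 0) : Matrix.toEuclideanCLM (𝕜 := ℝ) M axis = M 0 0 • axis := by
  ext i
  rw [toEuclideanCLM_axis]
  fin_cases i <;> simp [axis, h1, h2]

/-- Along the segment from 1 to M the lower 2 × 2 block has determinant (1 - s)² + s(1 - s) tr + s²
det, where tr and det are those of the block of M. This is positive when tr ≥ 0, and the axis
remains an eigenvector. -/
theorem isLinearPart_toEuclideanCLM_of_trace_nonneg {T : Set (E3 × E3)} {η : ℝ} (hη : 0 < η)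
    (hT : IsFlat T axis η) {M : Matrix (Fin 3) (Fin 3) ℝ} (h0 : 0 < M 0 0) (h1 : M 1 0 = 0)
    (h2 : M 2 0 = 0) (hdet : 0 < M 1 1 * M 2 2 - M 1 2 * M 2 1) (htr : 0 ≤ M 1 1 + M 2 2) :
    IsLinearPart T (Matrix.toEuclideanCLM (𝕜 := ℝ) M) := by
  have := isLinearPart_of_path axis_ne_zero hη hT
    (fun s : ℝ => (1 - s) • (1 : E3 →L[ℝ] E3) + s • Matrix.toEuclideanCLM (𝕜 := ℝ) M)
    (by fun_prop) (by simp) ?_ ?_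
  · have e : (1 - (1 : ℝ)) • (1 : E3 →L[ℝ] E3) + (1 : ℝ) • Matrix.toEuclideanCLM (𝕜 := ℝ) M =
        Matrix.toEuclideanCLM (𝕜 := ℝ) M := by
      ext x i
      simp
    exact e ▸ this
  · intro s hs
    have e : (1 - s) • (1 : E3 →L[ℝ] E3) + s • Matrix.toEuclideanCLM (𝕜 := ℝ) M =
        Matrix.toEuclideanCLM (𝕜 := ℝ) ((1 - s) • (1 : Matrix (Fin 3) (Fin 3) ℝ) + s • M) := by
      rw [map_add, map_smul, map_smul, map_one]
    simp only [e]
    rw [Matrix.det_toEuclideanCLM, Matrix.det_fin_three]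
    simp only [Matrix.add_apply, Matrix.smul_apply, Matrix.one_apply, h1, h2, smul_eq_mul]
    simp only [Fin.isValue, if_true, mul_one, one_ne_zero, if_false, mul_zero, zero_add, add_zero,
      Fin.reduceEq, sub_zero, zero_mul]
    obtain ⟨hs0, hs1⟩ := hs
    have f1 : 0 < 1 - s + s * M 0 0 := by
      rcases hs0.eq_or_lt with rfl | h
      · norm_num
      · have := mul_pos h h0
        linarith
    have f2 : 0 < (1 - s + s * M 1 1) * (1 - s + s * M 2 2) - s * M 1 2 * (s * M 2 1) := by
      have e2 : (1 - s + s * M 1 1) * (1 - s + s * M 2 2) - s * M 1 2 * (s * M 2 1) =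
        (1 - s) ^ 2 + s * (1 - s) * (M 1 1 + M 2 2) + s ^ 2 * (M 1 1 * M 2 2 - M 1 2 * M 2 1) := by
        ring
      rw [e2]
      have g1 : 0 ≤ s * (1 - s) * (M 1 1 + M 2 2) :=
        mul_nonneg (mul_nonneg hs0 (by linarith)) htr
      rcases hs0.eq_or_lt with rfl | h
      · norm_num
      · have g2 : 0 < s ^ 2 * (M 1 1 * M 2 2 - M 1 2 * M 2 1) := by positivity
        nlinarith [sq_nonneg (1 - s)]
    have f3 := mul_pos f1 f2
    refine ne_of_gt ?_
    linarith
  · intro s _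
    refine ⟨1 - s + s * M 0 0, ?_⟩
    simp only [add_apply, smul_apply, toEuclideanCLM_axis_eq_smul h1 h2]
    rw [add_smul, mul_smul]
    rfl

/-- Every orientation-preserving linear map that has the axis as eigenvector with positive
eigenvalue is the linear part of a diffeomorphism preserving a flat set. -/
theorem isLinearPart_of_axis {T : Set (E3 × E3)} {η : ℝ} (hη : 0 < η) (hT : IsFlat T axis η)
    {A : E3 →L[ℝ] E3} (hdet : 0 < A.det) {c : ℝ} (hc : 0 < c) (hA : A axis = c • axis) :
    IsLinearPart T A := by
  obtain ⟨M, rfl⟩ : ∃ M, Matrix.toEuclideanCLM (𝕜 := ℝ) (n := Fin 3) M = A :=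
    ⟨_, StarAlgEquiv.apply_symm_apply _ A⟩
  have hcol : ∀ i : Fin 3, M i 0 = (c • axis) i := fun i => by rw [← hA, toEuclideanCLM_axis]
  have h0 : M 0 0 = c := by rw [hcol]; simp [axis]
  have h1 : M 1 0 = 0 := by rw [hcol]; simp [axis]
  have h2 : M 2 0 = 0 := by rw [hcol]; simp [axis]
  rw [Matrix.det_toEuclideanCLM, Matrix.det_fin_three, h1, h2, h0] at hdet
  have hdet' : 0 < M 1 1 * M 2 2 - M 1 2 * M 2 1 := by
    refine pos_of_mul_pos_right (a := c) ?_ hc.le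
    linarith
  rcases le_total 0 (M 1 1 + M 2 2) with htr | htr
  · exact isLinearPart_toEuclideanCLM_of_trace_nonneg hη hT (h0 ▸ hc) h1 h2 hdet' htr
  -- For tr ≤ 0, split off a half turn about the axis, which negates the block. The half turn is the
  -- square of a quarter turn, whose block has trace 0.
  · have hJ : IsLinearPart T (Matrix.toEuclideanCLM (𝕜 := ℝ)
        (!![1, 0, 0; 0, 0, -1; 0, 1, 0] : Matrix (Fin 3) (Fin 3) ℝ)) :=
      isLinearPart_toEuclideanCLM_of_trace_nonneg hη hT (by simp) (by simp) (by simp) (by simp)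
        (by simp)
    have hM : IsLinearPart T (Matrix.toEuclideanCLM (𝕜 := ℝ)
        (!![M 0 0, M 0 1, M 0 2; 0, -M 1 1, -M 1 2; 0, -M 2 1, -M 2 2] :
          Matrix (Fin 3) (Fin 3) ℝ)) := by
      refine isLinearPart_toEuclideanCLM_of_trace_nonneg hη hT ?_ ?_ ?_ ?_ ?_
      · simpa [h0] using hc
      · simp
      · simp
      · simpa using hdet'
      · simp only [Matrix.of_apply, Matrix.cons_val', Matrix.cons_val_one, Matrix.cons_val_zero,
          Matrix.cons_val]
        linarith
    have := hJ.comp (hJ.comp hM)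
    rw [← ContinuousLinearMap.mul_def, ← ContinuousLinearMap.mul_def, ← map_mul, ← map_mul] at this
    convert this using 2
    ext i j
    fin_cases i <;> fin_cases j <;>
      simp [Matrix.mul_apply, Fin.sum_univ_three, h1, h2]

end Axis

/-! ### Knots in sum position near the unit ball. -/

section SumPosition

namespace OrientedKnot

theorem contDiff_coord (k : OrientedKnot) (i : Fin 3) : ContDiff ℝ ∞ fun t => k.toFun t i :=
  (EuclideanSpace.proj (𝕜 := ℝ) i).contDiff.comp k.smooth

theorem hasDerivAt_coord (k : OrientedKnot) (i : Fin 3) (t : ℝ) :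
    HasDerivAt (fun t => k.toFun t i) (deriv k.toFun t i) t :=
  (EuclideanSpace.proj (𝕜 := ℝ) i).hasFDerivAt.comp_hasDerivAt t (k.differentiable t).hasDerivAt

theorem continuous_deriv_coord (k : OrientedKnot) (i : Fin 3) :
    Continuous fun t => deriv k.toFun t i :=
  (EuclideanSpace.proj (𝕜 := ℝ) i).continuous.comp (k.smooth.continuous_deriv (by simp))

theorem smul_axis_zero (a : ℝ) : (a • axis) 0 = a := by simp [axis]

theorem norm_smul_axis (a : ℝ) : ‖a • axis‖ = |a| := by
  rw [norm_smul, norm_axis, mul_one, Real.norm_eq_abs]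

namespace InSumPosition

variable {k : OrientedKnot} (hk : k.InSumPosition)
include hk

theorem eq_smul_axis {t : ℝ} (ht : ‖k.toFun t‖ ≤ 2) : k.toFun t = k.toFun t 0 • axis := by
  have h : k.toFun t ∈ Set.range k.toFun ∩ Metric.closedBall 0 2 :=
    ⟨⟨t, rfl⟩, by simpa using ht⟩
  rw [hk.straight] at h
  obtain ⟨x, -, hx⟩ := h
  rw [hx, smul_axis_zero]

theorem mem_range_iff {x : E3} (hx : ‖x‖ ≤ 2) :
    x ∈ Set.range k.toFun ↔ ∃ a : ℝ, x = a • axis := by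
  constructor
  · rintro ⟨t, rfl⟩
    exact ⟨_, hk.eq_smul_axis hx⟩
  · rintro ⟨a, rfl⟩
    have : a • axis ∈ Set.range k.toFun ∩ Metric.closedBall 0 2 := by
      rw [hk.straight]
      exact ⟨a, by rwa [norm_smul_axis] at hx, rfl⟩
    exact this.1

theorem deriv_eq_smul_axis {t : ℝ} (ht : ‖k.toFun t‖ < 2) :
    deriv k.toFun t = deriv k.toFun t 0 • axis := by
  have h1 : ∀ᶠ s in nhds t, k.toFun s = k.toFun s 0 • axis := by
    filter_upwards [k.smooth.continuous.norm.continuousAt.eventually (gt_mem_nhds ht)] with s hs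
    exact hk.eq_smul_axis hs.le
  exact (k.differentiable t).hasDerivAt.unique
    (((k.hasDerivAt_coord 0 t).smul_const axis).congr_of_eventuallyEq h1)

theorem deriv_coord_ne_zero {t : ℝ} (ht : ‖k.toFun t‖ < 2) : deriv k.toFun t 0 ≠ 0 := by
  intro h
  have h1 := hk.deriv_eq_smul_axis ht
  rw [h, zero_smul] at h1
  exact k.immersion t h1

theorem norm_le_one {t : ℝ} (ht : t ∈ Set.Icc (0 : ℝ) (1 / 2)) : ‖k.toFun t‖ ≤ 1 := by
  rcases ht.1.eq_or_lt with rfl | h0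
  · rw [hk.enter, norm_neg, norm_axis]
  · rcases ht.2.eq_or_lt with rfl | h1
    · rw [hk.leave, norm_axis]
    · exact (hk.inside t ⟨h0, h1⟩).le

/-- Inside the ball of radius 2 the velocity is a nonzero multiple of the axis, so its sign is
constant on [0, 1/2]; the mean value theorem between -e and e makes it positive. -/
theorem deriv_coord_pos {t : ℝ} (ht : t ∈ Set.Icc (0 : ℝ) (1 / 2)) : 0 < deriv k.toFun t 0 := by
  obtain ⟨r, hr, hrd⟩ := exists_hasDerivAt_eq_slope (fun t => k.toFun t 0)
    (fun t => deriv k.toFun t 0) (show (0 : ℝ) < 1 / 2 by norm_num)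
    (k.contDiff_coord 0).continuous.continuousOn (fun s _ => k.hasDerivAt_coord 0 s)
  have h4 : 0 < deriv k.toFun r 0 := by
    rw [hrd, hk.leave, hk.enter]
    simp [axis]
  by_contra hc
  push Not at hc
  obtain ⟨s, hs, hs0⟩ := isPreconnected_Icc.intermediate_value ht (Set.Ioo_subset_Icc_self hr)
    (k.continuous_deriv_coord 0).continuousOn ⟨hc, h4.le⟩
  exact hk.deriv_coord_ne_zero ((hk.norm_le_one hs).trans_lt (by norm_num)) hs0

theorem exists_eq_smul_axis {a : ℝ} (ha : |a| ≤ 1) :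
    ∃ t ∈ Set.Icc (0 : ℝ) (1 / 2), k.toFun t = a • axis := by
  obtain ⟨t, ht, hta⟩ := intermediate_value_Icc (show (0 : ℝ) ≤ 1 / 2 by norm_num)
    (k.contDiff_coord 0).continuous.continuousOn
    (show a ∈ Set.Icc _ _ by
      rw [hk.enter, hk.leave]
      simpa [axis] using abs_le.1 ha)
  refine ⟨t, ht, ?_⟩
  rw [hk.eq_smul_axis ((hk.norm_le_one ht).trans one_le_two)]
  exact congrArg (· • axis) hta

/-- The arc over [0, 1/2] already fills the diameter of the unit ball, so injectivity leaves no room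
for other parameters. -/
theorem exists_mem_Icc_of_norm_le_one {t : ℝ} (ht : ‖k.toFun t‖ ≤ 1) :
    ∃ n : ℤ, t + n ∈ Set.Icc (0 : ℝ) (1 / 2) := by
  have h1 := hk.eq_smul_axis (ht.trans one_le_two)
  rw [h1, norm_smul_axis] at ht
  obtain ⟨s, hs, hst⟩ := hk.exists_eq_smul_axis ht
  rw [← h1] at hst
  obtain ⟨n, rfl⟩ := k.injective _ _ hst.symm
  exact ⟨n, hs⟩

theorem one_lt_norm {t : ℝ} (ht : t ∈ Set.Ioo (1 / 2 : ℝ) 1) : 1 < ‖k.toFun t‖ := by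
  by_contra hc
  push Not at hc
  obtain ⟨n, h1, h2⟩ := hk.exists_mem_Icc_of_norm_le_one hc
  have e1 : (n : ℝ) < 0 := by linarith [ht.1]
  have e2 : (-1 : ℝ) < n := by linarith [ht.2]
  have e3 : n < 0 := by exact_mod_cast e1
  have e4 : -1 < n := by exact_mod_cast e2
  omega

theorem one_le_norm {t : ℝ} (ht : t ∈ Set.Icc (1 / 2 : ℝ) 1) : 1 ≤ ‖k.toFun t‖ := by
  rcases ht.1.eq_or_lt with rfl | h0
  · rw [hk.leave, norm_axis]
  · rcases ht.2.eq_or_lt with rfl | h1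
    · rw [show (1 : ℝ) = 0 + 1 by norm_num, k.periodic, hk.enter, norm_neg, norm_axis]
      norm_num
    · exact (hk.one_lt_norm ⟨h0, h1⟩).le

theorem isFlat : IsFlat k.tangents axis 1 := by
  intro x w hx
  constructor
  · rintro ⟨t, c, hc, h1, h2⟩
    simp only at h1 h2
    subst h1 h2
    obtain ⟨n, hn⟩ := hk.exists_mem_Icc_of_norm_le_one hx.le
    have h3 := hk.deriv_coord_pos hn
    rw [k.deriv_add_int] at h3
    refine ⟨⟨_, hk.eq_smul_axis (hx.le.trans one_le_two)⟩, c * deriv k.toFun t 0, mul_pos hc h3, ?_⟩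
    rw [mul_smul, ← hk.deriv_eq_smul_axis (hx.trans one_lt_two)]
  · rintro ⟨⟨a, rfl⟩, c, hc, rfl⟩
    rw [norm_smul_axis] at hx
    obtain ⟨t, ht, hta⟩ := hk.exists_eq_smul_axis hx.le
    have h3 := hk.deriv_coord_pos ht
    refine ⟨t, c / deriv k.toFun t 0, div_pos hc h3, hta.symm, ?_⟩
    simp only
    rw [hk.deriv_eq_smul_axis ((hk.norm_le_one ht).trans_lt one_lt_two), smul_smul,
      smul_axis_zero, div_mul_cancel₀ _ h3.ne']

theorem toFun_one : k.toFun 1 = -axis := by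
  rw [show (1 : ℝ) = 0 + 1 by norm_num, k.periodic, hk.enter]

theorem eventually_half : ∀ᶠ t in nhds (1 / 2 : ℝ), ‖k.toFun t‖ < 2 ∧ 0 < deriv k.toFun t 0 := by
  refine (k.smooth.continuous.norm.continuousAt.eventually (gt_mem_nhds ?_)).and
    ((k.continuous_deriv_coord 0).continuousAt.eventually
      (lt_mem_nhds (hk.deriv_coord_pos ⟨by norm_num, le_rfl⟩)))
  change ‖k.toFun (1 / 2)‖ < 2
  rw [hk.leave, norm_axis]
  exact one_lt_two

theorem eventually_one : ∀ᶠ t in nhds (1 : ℝ), ‖k.toFun t‖ < 2 ∧ 0 < deriv k.toFun t 0 := by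
  refine (k.smooth.continuous.norm.continuousAt.eventually (gt_mem_nhds ?_)).and
    ((k.continuous_deriv_coord 0).continuousAt.eventually (lt_mem_nhds ?_))
  · change ‖k.toFun 1‖ < 2
    rw [hk.toFun_one, norm_neg, norm_axis]
    exact one_lt_two
  · have := hk.deriv_coord_pos (t := 0) ⟨le_rfl, by norm_num⟩
    rwa [← k.deriv_add_int 0 1, Int.cast_one, zero_add] at this

end InSumPosition

end OrientedKnot

end SumPosition

/-! ### Reflections and reversal of orientation. -/

section Reflections

/-- The reflection `(x, y, z) ↦ (-x, y, z)`. -/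
noncomputable def reflectCLM : E3 →L[ℝ] E3 :=
  Matrix.toEuclideanCLM (𝕜 := ℝ) !![-1, 0, 0; 0, 1, 0; 0, 0, 1]

theorem reflectCLM_apply (x : E3) : reflectCLM x = !₂[-x 0, x 1, x 2] := by
  ext i
  rw [reflectCLM, Matrix.ofLp_toEuclideanCLM]
  fin_cases i <;> simp [Matrix.mulVec, dotProduct, Fin.sum_univ_three]

theorem reflectCLM_reflectCLM (x : E3) : reflectCLM (reflectCLM x) = x := by
  ext i
  simp only [reflectCLM_apply]
  fin_cases i <;> simp

theorem norm_reflectCLM (x : E3) : ‖reflectCLM x‖ = ‖x‖ := by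
  rw [reflectCLM_apply, EuclideanSpace.norm_eq, EuclideanSpace.norm_eq]
  simp [Fin.sum_univ_three]

theorem reflectCLM_axis : reflectCLM axis = -axis := by
  ext i
  rw [reflectCLM_apply]
  fin_cases i <;> simp [axis]

theorem det_reflectCLM : reflectCLM.det = -1 := by
  rw [reflectCLM, Matrix.det_toEuclideanCLM, Matrix.det_fin_three]
  simp

theorem det_mirrorCLM : mirrorCLM.det = -1 := by
  have : mirrorCLM = Matrix.toEuclideanCLM (𝕜 := ℝ)
      (!![1, 0, 0; 0, 1, 0; 0, 0, -1] : Matrix (Fin 3) (Fin 3) ℝ) := by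
    ext x i
    rw [mirrorCLM_apply, Matrix.ofLp_toEuclideanCLM]
    fin_cases i <;> simp [Matrix.mulVec, dotProduct, Fin.sum_univ_three, mirror]
  rw [this, Matrix.det_toEuclideanCLM, Matrix.det_fin_three]
  simp

/-- `reflectCLM` as a permutation. -/
noncomputable def reflectPerm : Equiv.Perm E3 :=
  Function.Involutive.toPerm reflectCLM reflectCLM_reflectCLM

/-- `mirror` as a permutation. -/
noncomputable def mirrorPerm : Equiv.Perm E3 :=
  Function.Involutive.toPerm mirrorCLM mirror_mirror

/-- The two determinants -1 cancel; this is how the map built from `mirror` enters the oriented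
group. -/
theorem reflectPerm_mul_mul_mirrorPerm_mem {f : Equiv.Perm E3} (hf : f ∈ orientedDiffeo E3) :
    reflectPerm * f * mirrorPerm ∈ orientedDiffeo E3 := by
  refine ⟨reflectCLM.contDiff.comp (hf.1.comp mirrorCLM.contDiff),
    mirrorCLM.contDiff.comp (hf.2.1.comp reflectCLM.contDiff), fun x => ?_⟩
  have h : HasFDerivAt (⇑(reflectPerm * f * mirrorPerm))
      (reflectCLM.comp ((fderiv ℝ f (mirrorCLM x)).comp mirrorCLM)) x :=
    reflectCLM.hasFDerivAt.comp x ((orientedDiffeo.differentiable hf _).hasFDerivAt.comp x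
      mirrorCLM.hasFDerivAt)
  rw [h.fderiv, ContinuousLinearMap.det_mul', ContinuousLinearMap.det_mul', det_reflectCLM,
    det_mirrorCLM]
  have := hf.2.2 (mirrorCLM x)
  linarith

/-- The set of the negatives of the tangent vectors in `T`. -/
def negTangents {E : Type*} [Neg E] (T : Set (E × E)) : Set (E × E) := {p | (p.1, -p.2) ∈ T}

theorem Carries.negTangents {E : Type*} [NormedAddCommGroup E] [NormedSpace ℝ E] {f : E → E}
    {S T : Set (E × E)} (h : Carries f S T) : Carries f (negTangents S) (negTangents T) := by
  intro x v
  change (x, -v) ∈ S ↔ (f x, -fderiv ℝ f x v) ∈ T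
  rw [h, map_neg]

/-- The sign arises because -K traverses the mirror image backwards. -/
theorem OrientedKnot.carries_mirror (K : OrientedKnot) :
    Carries mirrorCLM K.tangents (negTangents K.mirrorReverse.tangents) := by
  have hd : ∀ t, deriv K.mirrorReverse.toFun t = -mirrorCLM (deriv K.toFun (-t)) := by
    intro t
    have h1 : HasDerivAt (fun s : ℝ => K.toFun (-s)) ((-1 : ℝ) • deriv K.toFun (-t)) t :=
      (K.differentiable (-t)).hasDerivAt.scomp t (hasDerivAt_neg t)
    have h2 : HasDerivAt K.mirrorReverse.toFun
        (mirrorCLM ((-1 : ℝ) • deriv K.toFun (-t))) t :=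
      mirrorCLM.hasFDerivAt.comp_hasDerivAt t h1
    rw [h2.deriv, neg_one_smul, map_neg]
  intro x v
  rw [mirrorCLM.fderiv]
  constructor
  · rintro ⟨t, c, hc, h1, h2⟩
    simp only at h1 h2
    subst h1 h2
    refine ⟨-t, c, hc, ?_, ?_⟩
    · change mirror (K.toFun t) = mirror (K.toFun (- -t))
      rw [neg_neg]
    · simp only [hd, neg_neg, map_smul, smul_neg]
  · rintro ⟨t, c, hc, h1, h2⟩
    simp only [hd, smul_neg, neg_inj] at h1 h2
    refine ⟨-t, c, hc, mirrorPerm.injective h1, mirrorPerm.injective ?_⟩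
    change mirrorCLM v = mirrorCLM (c • deriv K.toFun (-t))
    rw [h2, map_smul]

theorem Carries.exists_mem_iff {E : Type*} [NormedAddCommGroup E] [NormedSpace ℝ E]
    {f : Equiv.Perm E} {S T : Set (E × E)} (h : Carries f S T) (hf : f ∈ orientedDiffeo E) (x : E) :
    (∃ v, (x, v) ∈ S) ↔ ∃ w, (f x, w) ∈ T := by
  constructor
  · rintro ⟨v, hv⟩
    exact ⟨_, (h x v).1 hv⟩
  · rintro ⟨w, hw⟩
    have := (h.inv hf _ _).1 hw
    rw [show f⁻¹ (f x) = x from f.symm_apply_apply x] at this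
    exact ⟨_, this⟩

end Reflections

/-! ### Shrinking the unit ball along the axis. -/

section Shrinking

/-- A diffeomorphism that shrinks the unit ball and preserves all knots in sum position. -/
theorem exists_shrinking {ε : ℝ} (hε : 0 < ε) :
    ∃ f ∈ orientedDiffeo E3, ∃ r : ℝ, 0 < r ∧ r < ε ∧ (∀ x, ‖x‖ ≤ 1 → f x = r • x) ∧
      ∀ k : OrientedKnot, k.InSumPosition →
        ∀ x, x ∈ Set.range k.toFun ↔ f x ∈ Set.range k.toFun := by
  let β : ContDiffBump (0 : E3) := ⟨1, 3 / 2, by norm_num, by norm_num⟩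
  have hβ0 : ∀ x : E3, 3 / 2 ≤ ‖x‖ → β x = 0 := fun x hx =>
    β.zero_of_le_dist (by simpa [dist_zero_right] using hx)
  have hβ1 : ∀ x : E3, ‖x‖ ≤ 1 → β x = 1 := fun x hx =>
    β.one_of_mem_closedBall (by simpa using hx)
  have hh : ContDiff ℝ ∞ fun x : E3 => β x • x := β.contDiff.smul contDiff_id
  have hhc : HasCompactSupport fun x : E3 => β x • x := β.hasCompactSupport.smul_right
  obtain ⟨M, hM⟩ := (hhc.fderiv (𝕜 := ℝ)).exists_bound_of_continuous
    (hh.continuous_fderiv (by simp))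
  have hM0 : 0 ≤ M := (norm_nonneg _).trans (hM 0)
  set c : ℝ := 1 / (2 * (M + 1)) with hc
  have hc0 : 0 < c := by positivity
  have hc1 : c ≤ 1 / 2 := by
    rw [hc, div_le_div_iff₀ (by positivity) (by norm_num)]
    linarith
  have hg : ContDiff ℝ ∞ fun x : E3 => (-c) • β x • x := hh.const_smul (-c)
  have hb : ∀ x, ‖fderiv ℝ (fun x : E3 => (-c) • β x • x) x‖ ≤ 1 / 2 := by
    intro x
    have h1 : HasFDerivAt (fun x : E3 => (-c) • β x • x)
        ((-c) • fderiv ℝ (fun x : E3 => β x • x) x) x :=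
      (hh.differentiable (by simp) x).hasFDerivAt.const_smul (-c)
    rw [h1.fderiv, norm_smul, norm_neg, Real.norm_of_nonneg hc0.le, hc, div_mul_eq_mul_div, one_mul,
      div_le_div_iff₀ (by positivity) (by norm_num)]
    linarith [hM x]
  obtain ⟨f, hf, hfg⟩ := exists_orientedDiffeo_add hg hb
  have hfs : ∀ x, f x = (1 - c * β x) • x := fun x => by
    rw [hfg, sub_smul, one_smul, neg_smul, ← sub_eq_add_neg, smul_smul]
  have hpos : ∀ x, 0 < 1 - c * β x ∧ 1 - c * β x ≤ 1 := fun x => by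
    have h1 : β x ≤ 1 := β.le_one
    have h2 : 0 ≤ β x := β.nonneg
    constructor <;> nlinarith
  have hf1 : ∀ x, ‖x‖ ≤ 1 → f x = (1 - c) • x := fun x hx => by rw [hfs, hβ1 x hx, mul_one]
  -- f is a positive radial rescaling, so it respects the diameter in the ball of radius 2, and it
  -- is the identity beyond radius 3/2.
  have hfk : ∀ k : OrientedKnot, k.InSumPosition →
      ∀ x, x ∈ Set.range k.toFun ↔ f x ∈ Set.range k.toFun := by
    intro k hk x
    rcases le_or_gt ‖x‖ 2 with hx | hx
    · have hfx : ‖f x‖ ≤ 2 := by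
        rw [hfs, norm_smul, Real.norm_of_nonneg (hpos x).1.le]
        nlinarith [(hpos x).2, norm_nonneg x]
      rw [hk.mem_range_iff hx, hk.mem_range_iff hfx, hfs]
      constructor
      · rintro ⟨a, ha⟩
        exact ⟨(1 - c * β x) * a, by rw [mul_smul, ← ha]⟩
      · rintro ⟨a, ha⟩
        refine ⟨(1 - c * β x)⁻¹ * a, ?_⟩
        rw [mul_smul, ← ha, smul_smul, inv_mul_cancel₀ (hpos x).1.ne', one_smul]
    · rw [hfs, hβ0 x (by linarith), mul_zero, sub_zero, one_smul]
  -- One application only scales the unit ball by 1 - c, so f is iterated.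
  obtain ⟨n, hn⟩ := exists_pow_lt_of_lt_one hε (show 1 - c < 1 by linarith)
  refine ⟨f ^ n, pow_mem hf n, (1 - c) ^ n, pow_pos (by linarith) n, hn, ?_, fun k hk => ?_⟩
  · clear hn
    induction n with
    | zero => intro x _; simp
    | succ n ih =>
      intro x hx
      have h1 : ‖(1 - c) • x‖ ≤ 1 := by
        rw [norm_smul, Real.norm_of_nonneg (by linarith)]
        nlinarith [norm_nonneg x]
      rw [pow_succ, Equiv.Perm.mul_apply, hf1 x hx, ih _ h1, smul_smul, pow_succ]
  · clear hn
    induction n with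
    | zero => intro x; simp
    | succ n ih =>
      intro x
      rw [pow_succ, Equiv.Perm.mul_apply, ← ih, ← hfk k hk]

end Shrinking

/-! ### A diffeomorphism between the summands, standard on the unit ball. -/

section Standardization

/-- If `k₁` and `k₂` are in sum position and represent a knot and its reversed mirror image, then
a diffeomorphism that is a reflection on the unit ball carries `k₁` to `k₂`. -/
theorem exists_standard_diffeo {K k₁ k₂ : OrientedKnot} (h₁ : K.Isotopic k₁)
    (h₂ : K.mirrorReverse.Isotopic k₂) (p₁ : k₁.InSumPosition) (p₂ : k₂.InSumPosition) :
    ∃ f : Equiv.Perm E3, ContDiff ℝ ∞ f ∧ ContDiff ℝ ∞ f.symm ∧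
      (∀ x, ‖x‖ ≤ 1 → f x = reflectCLM x) ∧
      ∀ x, x ∈ Set.range k₁.toFun ↔ f x ∈ Set.range k₂.toFun := by
  obtain ⟨f₁, hf₁, c₁⟩ := h₁.exists_carries
  obtain ⟨f₂, hf₂, c₂⟩ := h₂.exists_carries
  have hmir : ∀ x, (∃ v, (x, v) ∈ K.tangents) → ∃ w, (mirrorCLM x, w) ∈ K.mirrorReverse.tangents :=
    fun x ⟨v, hv⟩ => ⟨_, (K.carries_mirror x v).1 hv⟩
  have h01 : ((0 : E3), axis) ∈ k₁.tangents :=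
    (p₁.isFlat 0 axis (by simp)).2 ⟨⟨0, by simp⟩, 1, one_pos, by simp⟩
  have h02 : ((0 : E3), axis) ∈ k₂.tangents :=
    (p₂.isFlat 0 axis (by simp)).2 ⟨⟨0, by simp⟩, 1, one_pos, by simp⟩
  obtain ⟨t₀, ht₀⟩ := (k₂.exists_mem_tangents_iff 0).1 ⟨_, h02⟩
  obtain ⟨t, ht⟩ : f₂ (mirrorCLM (f₁⁻¹ 0)) ∈ Set.range k₂.toFun := by
    rw [← k₂.exists_mem_tangents_iff, ← c₂.exists_mem_iff hf₂]
    exact hmir _ (((c₁.inv hf₁).exists_mem_iff (inv_mem hf₁) 0).1 ⟨_, h01⟩)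
  -- P slides the image of the origin along `k₂` back to the origin.
  obtain ⟨P, hP, cP, hPt⟩ := k₂.exists_carries_point t t₀
  set T₁ := k₁.tangents with hT₁
  -- The reflected and reversed `k₂`. Reflection and reversal each flip the axis, so T₂ runs along
  -- the axis in the same direction as T₁.
  set T₂ : Set (E3 × E3) := {p | (reflectCLM p.1, -reflectCLM p.2) ∈ k₂.tangents} with hT₂
  have flat₁ : IsFlat T₁ axis 1 := p₁.isFlat
  have flat₂ : IsFlat T₂ axis 1 := by
    intro x w hx
    refine (p₂.isFlat (reflectCLM x) (-reflectCLM w) (by rwa [norm_reflectCLM])).trans ?_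
    refine and_congr ⟨?_, ?_⟩ ⟨?_, ?_⟩
    · rintro ⟨s, hs⟩
      exact ⟨-s, by rw [← reflectCLM_reflectCLM x, hs, map_smul, reflectCLM_axis, smul_neg,
        neg_smul]⟩
    · rintro ⟨s, rfl⟩
      exact ⟨-s, by rw [map_smul, reflectCLM_axis, smul_neg, neg_smul]⟩
    · rintro ⟨c, hc, h⟩
      refine ⟨c, hc, ?_⟩
      rw [← reflectCLM_reflectCLM w, ← neg_neg (reflectCLM w), h, map_neg, map_smul,
        reflectCLM_axis, smul_neg, neg_neg]
    · rintro ⟨c, hc, rfl⟩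
      exact ⟨c, hc, by rw [map_smul, reflectCLM_axis, smul_neg, neg_neg]⟩
  have cref : Carries reflectCLM (negTangents k₂.tangents) T₂ := by
    intro x v
    rw [reflectCLM.fderiv]
    change (x, -v) ∈ k₂.tangents ↔ (reflectCLM (reflectCLM x), -reflectCLM (reflectCLM v)) ∈ k₂.tangents
    rw [reflectCLM_reflectCLM, reflectCLM_reflectCLM]
  set R : Equiv.Perm E3 := reflectPerm * (P * f₂) * mirrorPerm * f₁⁻¹ with hR
  have hRm : R ∈ orientedDiffeo E3 :=
    mul_mem (reflectPerm_mul_mul_mirrorPerm_mem (mul_mem hP hf₂)) (inv_mem hf₁)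
  have hPf : P * f₂ ∈ orientedDiffeo E3 := mul_mem hP hf₂
  have cR : Carries R T₁ T₂ := by
    have e1 := (cref.comp (cP.mul c₂ hP hf₂).negTangents reflectCLM.differentiable
      (orientedDiffeo.differentiable hPf)).comp K.carries_mirror
      (reflectCLM.differentiable.comp (orientedDiffeo.differentiable hPf))
      mirrorCLM.differentiable
    exact e1.comp (c₁.inv hf₁) (orientedDiffeo.differentiable
      (reflectPerm_mul_mul_mirrorPerm_mem hPf)) (orientedDiffeo.differentiable (inv_mem hf₁))
  have hR0 : R 0 = 0 := by
    change reflectCLM (P (f₂ (mirrorCLM (f₁⁻¹ 0)))) = 0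
    rw [← ht, hPt, ht₀, map_zero]
  -- Both orientations have been respected, so the eigenvalue of the derivative on the axis is
  -- positive. Hence some g preserving T₁ has the same derivative at 0, and R g⁻¹ has derivative 1.
  obtain ⟨-, c, hc, hAc⟩ := (flat₂ _ _ (by rw [hR0]; simp)).1 ((cR 0 axis).1 h01)
  obtain ⟨g, hg, cg, hg0, hgA⟩ := isLinearPart_of_axis one_pos flat₁ (hRm.2.2 0) hc hAc
  set R₂ : Equiv.Perm E3 := R * g⁻¹ with hR₂
  have hR₂m : R₂ ∈ orientedDiffeo E3 := mul_mem hRm (inv_mem hg)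
  have cR₂ : Carries R₂ T₁ T₂ := cR.mul (cg.inv hg) hRm (inv_mem hg)
  have hg0' : g.symm 0 = 0 := by rw [g.symm_apply_eq, hg0]
  have hR₂0 : R₂ 0 = 0 := by
    change R (g.symm 0) = 0
    rw [hg0', hR0]
  have hR₂1 : fderiv ℝ R₂ 0 = 1 := by
    have e1 := fderiv_comp (0 : E3) (orientedDiffeo.differentiable hRm (g.symm 0))
      (orientedDiffeo.differentiable_symm hg 0)
    have e2 := fderiv_eq_id_of_leftInverse (f := g.symm) (g := g) (x := 0)
      (Filter.Eventually.of_forall fun y => g.apply_symm_apply y)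
      (orientedDiffeo.differentiable_symm hg 0) (orientedDiffeo.differentiable hg _)
    rw [hg0'] at e1 e2
    rw [hgA] at e2
    exact e1.trans e2
  have hcont : ∀ᶠ x in nhds (0 : E3), ‖R₂ x‖ < 1 :=
    (orientedDiffeo.contDiff hR₂m).continuous.norm.continuousAt.eventually
      (gt_mem_nhds (by simp [hR₂0]))
  obtain ⟨ρ, hρ, hρR⟩ := Metric.eventually_nhds_iff_ball.1 hcont
  obtain ⟨c₀, hc₀, H⟩ := exists_carries_of_germ E3
  -- R₂ maps the axis near 0 into the axis because T₁ and T₂ are both flat there. So W realizes its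
  -- germ while preserving T₁, and R₂ W⁻¹ is the identity near 0.
  obtain ⟨W, hW, cW, hWR⟩ := H R₂ hR₂m.1 hR₂0 (by simpa [hR₂1] using hc₀.le) T₁ axis 1 (min ρ 1)
    axis_ne_zero one_pos (lt_min hρ one_pos) flat₁ (by
      intro s hs
      have e1 : (s • axis, axis) ∈ T₁ := (flat₁ _ _ (hs.trans_le (min_le_right _ _))).2
        ⟨⟨s, rfl⟩, 1, one_pos, (one_smul _ _).symm⟩
      have e2 : ‖R₂ (s • axis)‖ < 1 := hρR _ (by simpa using hs.trans_le (min_le_left _ _))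
      exact ((flat₂ _ _ e2).1 ((cR₂ _ _).1 e1)).1)
  set R₃ : Equiv.Perm E3 := R₂ * W⁻¹ with hR₃
  have hR₃m : R₃ ∈ orientedDiffeo E3 := mul_mem hR₂m (inv_mem hW)
  have cR₃ : Carries R₃ T₁ T₂ := cR₂.mul (cW.inv hW) hR₂m (inv_mem hW)
  have hR₃0 : ∀ᶠ x in nhds (0 : E3), R₃ x = x := by
    have e0 : W.symm 0 = 0 := by rw [W.symm_apply_eq, hWR.self_of_nhds, hR₂0]
    have e1 : Filter.Tendsto W.symm (nhds 0) (nhds 0) := by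
      have := (orientedDiffeo.contDiff_symm hW).continuous.tendsto 0
      rwa [e0] at this
    filter_upwards [e1.eventually hWR] with x hx
    rw [W.apply_symm_apply] at hx
    exact hx.symm
  obtain ⟨ε, hε, hεR⟩ := Metric.eventually_nhds_iff_ball.1 hR₃0
  have hrange : ∀ x, x ∈ Set.range k₁.toFun ↔ reflectCLM (R₃ x) ∈ Set.range k₂.toFun := by
    intro x
    rw [← k₁.exists_mem_tangents_iff, ← k₂.exists_mem_tangents_iff, cR₃.exists_mem_iff hR₃m]
    constructor
    · rintro ⟨w, hw⟩
      exact ⟨_, hw⟩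
    · rintro ⟨w, hw⟩
      refine ⟨-reflectCLM w, ?_⟩
      change (reflectCLM (R₃ x), -reflectCLM (-reflectCLM w)) ∈ k₂.tangents
      rwa [map_neg, neg_neg, reflectCLM_reflectCLM]
  obtain ⟨S, hS, r, hr, hrε, hS1, hSk⟩ := exists_shrinking hε
  -- S maps the unit ball into the ball where R₃ is the identity, acts there as a scaling that
  -- commutes with the reflection, and preserves both knots.
  refine ⟨S⁻¹ * (reflectPerm * R₃) * S,
    (orientedDiffeo.contDiff_symm hS).comp ((reflectCLM.contDiff.comp hR₃m.1).comp hS.1),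
    (orientedDiffeo.contDiff_symm hS).comp ((hR₃m.2.1.comp reflectCLM.contDiff).comp hS.1),
    fun x hx => ?_, fun x => ?_⟩
  · change S.symm (reflectCLM (R₃ (S x))) = _
    have e1 : r • x ∈ Metric.ball (0 : E3) ε := by
      rw [mem_ball_zero_iff, norm_smul, Real.norm_of_nonneg hr.le]
      nlinarith [norm_nonneg x]
    rw [S.symm_apply_eq, hS1 x hx, hεR _ e1, hS1 _ (by rwa [norm_reflectCLM]), map_smul]
  · rw [hSk k₁ p₁, hrange, hSk k₂ p₂ ((S⁻¹ * (reflectPerm * R₃) * S) x)]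
    change _ ↔ S (S.symm (reflectCLM (R₃ (S x)))) ∈ Set.range k₂.toFun
    rw [S.apply_symm_apply]

end Standardization

/-! ### The half-spun disk, parametrized by a hemisphere. -/

section Hemisphere

/-- The Euclidean plane. -/
abbrev E2 : Type := EuclideanSpace ℝ (Fin 2)

theorem contDiff_euclidean_apply {n : ℕ} (i : Fin n) :
    ContDiff ℝ ∞ fun z : EuclideanSpace ℝ (Fin n) => z i :=
  (EuclideanSpace.proj (𝕜 := ℝ) i).contDiff

/-- The denominator in the formula for the inverse stereographic projection. -/
noncomputable def stereoDenom (z : E2) : ℝ := 1 + z 0 ^ 2 + z 1 ^ 2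

/-- The first coordinate of the inverse stereographic projection of the plane to the sphere. -/
noncomputable def stereoS (z : E2) : ℝ := 2 * z 0 / stereoDenom z

/-- The second coordinate of the inverse stereographic projection. -/
noncomputable def stereoP (z : E2) : ℝ := 2 * z 1 / stereoDenom z

/-- The height coordinate of the inverse stereographic projection. -/
noncomputable def stereoQ (z : E2) : ℝ := 2 / stereoDenom z - 1

theorem stereoDenom_pos (z : E2) : 0 < stereoDenom z := by unfold stereoDenom; positivity

theorem contDiff_stereoDenom : ContDiff ℝ ∞ stereoDenom :=
  (contDiff_const.add ((contDiff_euclidean_apply 0).pow 2)).add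
    ((contDiff_euclidean_apply 1).pow 2)

theorem contDiff_stereoS : ContDiff ℝ ∞ stereoS :=
  (contDiff_const.mul (contDiff_euclidean_apply 0)).div contDiff_stereoDenom
    fun z => (stereoDenom_pos z).ne'

theorem contDiff_stereoP : ContDiff ℝ ∞ stereoP :=
  (contDiff_const.mul (contDiff_euclidean_apply 1)).div contDiff_stereoDenom
    fun z => (stereoDenom_pos z).ne'

theorem contDiff_stereoQ : ContDiff ℝ ∞ stereoQ :=
  (contDiff_const.div contDiff_stereoDenom fun z => (stereoDenom_pos z).ne').sub contDiff_const

theorem stereo_sq (z : E2) : stereoS z ^ 2 + stereoP z ^ 2 + stereoQ z ^ 2 = 1 := by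
  have h := (stereoDenom_pos z).ne'
  unfold stereoS stereoP stereoQ
  field_simp
  unfold stereoDenom
  ring

theorem one_add_stereoQ_mul (z : E2) : (1 + stereoQ z) * stereoDenom z = 2 := by
  have h := (stereoDenom_pos z).ne'
  unfold stereoQ
  field_simp
  ring

theorem stereoQ_mul_zero (z : E2) : (1 + stereoQ z) * z 0 = stereoS z := by
  unfold stereoQ stereoS
  ring

theorem stereoQ_mul_one (z : E2) : (1 + stereoQ z) * z 1 = stereoP z := by
  unfold stereoQ stereoP
  ring

theorem one_add_stereoQ_pos (z : E2) : 0 < 1 + stereoQ z := by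
  unfold stereoQ
  have := stereoDenom_pos z
  have : 0 < 2 / stereoDenom z := by positivity
  linarith

theorem stereoS_mem (z : E2) : stereoS z ∈ Set.Icc (-1 : ℝ) 1 := by
  have h := stereo_sq z
  constructor <;> nlinarith [sq_nonneg (stereoP z), sq_nonneg (stereoQ z)]

theorem norm_sq_eq (z : E2) : ‖z‖ ^ 2 = z 0 ^ 2 + z 1 ^ 2 := by
  rw [EuclideanSpace.norm_sq_eq]
  simp

/-- A vector killed by the derivative of the disk map is also killed by the derivative of everything
recoverable from that map; injectivity of the derivative is proved this way. -/
theorem fderiv_apply_eq_zero_of_comp {E F G : Type*} [NormedAddCommGroup E] [NormedSpace ℝ E]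
    [NormedAddCommGroup F] [NormedSpace ℝ F] [NormedAddCommGroup G] [NormedSpace ℝ G]
    {f : E → F} {g : F → G} {z v : E} (hg : DifferentiableAt ℝ g (f z))
    (hf : DifferentiableAt ℝ f z) (hv : fderiv ℝ f z v = 0) :
    fderiv ℝ (fun x => g (f x)) z v = 0 := by
  have := fderiv_comp z hg hf
  rw [show (fun x => g (f x)) = g ∘ f from rfl, this, ContinuousLinearMap.comp_apply, hv, map_zero]

/-- A half-spun arc, transported by an embedding of `ℝ³ ∖ {0}`, is an embedded disk. The arc is
`s ↦ exp (b s * √(1 - s ^ 2)) • u s` for `s ∈ [-1, 1]`, in polar coordinates. -/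
theorem OrientedKnot.boundsDisk_of_arc {J : OrientedKnot} {b : ℝ → ℝ} {u : ℝ → E3}
    (hb : ∀ s ∈ Set.Icc (-1 : ℝ) 1, ContDiffAt ℝ ∞ b s)
    (hu : ∀ s ∈ Set.Icc (-1 : ℝ) 1, ContDiffAt ℝ ∞ u s)
    (hb0 : ∀ s ∈ Set.Icc (-1 : ℝ) 1, 0 < b s) (hu1 : ∀ s ∈ Set.Icc (-1 : ℝ) 1, ‖u s‖ = 1)
    (hinj : Set.InjOn (fun s => Real.exp (b s * √(1 - s ^ 2)) • u s) (Set.Icc (-1) 1))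
    (himm : ∀ s ∈ Set.Icc (-1 : ℝ) 1, deriv u s = 0 → deriv b s * (1 - s ^ 2) - b s * s ≠ 0)
    {Ψ Θ : E3 → E3} (hΨ : ∀ x ≠ 0, ContDiffAt ℝ ∞ Ψ x) (hΘΨ : ∀ x ≠ 0, Θ (Ψ x) = x)
    (hΘ : ∀ x ≠ 0, DifferentiableAt ℝ Θ (Ψ x))
    (hJ : ∀ y, y ∈ Set.range J.toFun ↔ ∃ s ∈ Set.Icc (-1 : ℝ) 1, ∃ r : ℝ, r ^ 2 = 1 - s ^ 2 ∧
      y = Ψ (Real.exp (b s * r) • u s)) : J.BoundsDisk := by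
  set m : E2 → ℝ := fun z => b (stereoS z) * stereoP z with hm
  set h : E2 → ℝ := fun z => b (stereoS z) * stereoQ z with hh
  set w : E2 → E3 := fun z => u (stereoS z) with hw
  set y : E2 → E3 := fun z => Real.exp (m z) • w z with hy
  set φ : E2 → E4 := fun z => !₂[Ψ (y z) 0, Ψ (y z) 1, Ψ (y z) 2, h z] with hφ
  have hw1 : ∀ z, ‖w z‖ = 1 := fun z => hu1 _ (stereoS_mem z)
  have hyn : ∀ z, ‖y z‖ = Real.exp (m z) := fun z => by
    rw [hy]
    simp only [norm_smul, hw1, mul_one, Real.norm_eq_abs, Real.abs_exp]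
  have hy0 : ∀ z, y z ≠ 0 := fun z => by
    rw [← norm_ne_zero_iff, hyn]
    exact (Real.exp_pos _).ne'
  have hbs : ContDiff ℝ ∞ fun z => b (stereoS z) := contDiff_iff_contDiffAt.2 fun z =>
    (hb _ (stereoS_mem z)).comp z contDiff_stereoS.contDiffAt
  have hws : ContDiff ℝ ∞ w := contDiff_iff_contDiffAt.2 fun z =>
    (hu _ (stereoS_mem z)).comp z contDiff_stereoS.contDiffAt
  have hms : ContDiff ℝ ∞ m := hbs.mul contDiff_stereoP
  have hhs : ContDiff ℝ ∞ h := hbs.mul contDiff_stereoQ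
  have hys : ContDiff ℝ ∞ y := hms.exp.smul hws
  have hΨy : ContDiff ℝ ∞ fun z => Ψ (y z) := contDiff_iff_contDiffAt.2 fun z =>
    (hΨ _ (hy0 z)).comp z hys.contDiffAt
  have hφs : ContDiff ℝ ∞ φ := by
    rw [contDiff_euclidean]
    intro i
    have hc : ∀ j : Fin 3, ContDiff ℝ ∞ fun z => Ψ (y z) j := fun j =>
      (contDiff_euclidean_apply j).comp hΨy
    fin_cases i
    exacts [hc 0, hc 1, hc 2, hhs]
  have hφd : Differentiable ℝ φ := hφs.differentiable (by simp)
  -- recovering the polar coordinates from the point of the disk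
  set π : E4 →L[ℝ] E3 := (EuclideanSpace.equiv (Fin 3) ℝ).symm.toContinuousLinearMap.comp
    (ContinuousLinearMap.pi ![EuclideanSpace.proj 0, EuclideanSpace.proj 1, EuclideanSpace.proj 2])
    with hπ
  have hπφ : ∀ z, π (φ z) = Ψ (y z) := fun z => by
    ext i
    fin_cases i <;> simp [hπ, hφ]
  have hyφ : ∀ z, y z = Θ (π (φ z)) := fun z => by rw [hπφ, hΘΨ _ (hy0 z)]
  have hmy : ∀ z, m z = Real.log ‖y z‖ := fun z => by rw [hyn, Real.log_exp]
  have hwy : ∀ z, w z = ‖y z‖⁻¹ • y z := fun z => by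
    rw [hyn, hy]
    simp only
    rw [smul_smul, inv_mul_cancel₀ (Real.exp_pos _).ne', one_smul]
  have hφh : ∀ z, h z = φ z 3 := fun z => rfl
  have hinjφ : Function.Injective φ := by
    intro z z' hzz
    have ey : y z = y z' := by rw [hyφ, hyφ, hzz]
    have em : m z = m z' := by rw [hmy, hmy, ey]
    have ew : w z = w z' := by rw [hwy, hwy, ey]
    have eh : h z = h z' := by rw [hφh, hφh, hzz]
    -- m and h are rotated coordinates, and m² + h² undoes the rotation. Together with the direction
    -- this yields the original arc point, hence s.
    have hsq : ∀ z, (b (stereoS z) * √(1 - stereoS z ^ 2)) ^ 2 = m z ^ 2 + h z ^ 2 := fun z => by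
      have e1 := stereo_sq z
      rw [mul_pow, Real.sq_sqrt (by nlinarith [sq_nonneg (stereoP z), sq_nonneg (stereoQ z)])]
      simp only [hm, hh]
      rw [mul_pow, mul_pow, ← mul_add]
      congr 1
      linarith
    have hnn : ∀ z, 0 ≤ b (stereoS z) * √(1 - stereoS z ^ 2) := fun z =>
      mul_nonneg (hb0 _ (stereoS_mem z)).le (Real.sqrt_nonneg _)
    have e1 : b (stereoS z) * √(1 - stereoS z ^ 2) = b (stereoS z') * √(1 - stereoS z' ^ 2) := by
      rw [← sq_eq_sq₀ (hnn z) (hnn z'), hsq, hsq, em, eh]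
    have es : stereoS z = stereoS z' := hinj (stereoS_mem z) (stereoS_mem z') (by
      simp only
      rw [e1]
      exact congrArg (_ • ·) ew)
    have hbz := (hb0 _ (stereoS_mem z')).ne'
    have ep : stereoP z = stereoP z' := by
      simp only [hm, es] at em
      exact mul_left_cancel₀ hbz em
    have eq : stereoQ z = stereoQ z' := by
      simp only [hh, es] at eh
      exact mul_left_cancel₀ hbz eh
    have hq0 := (one_add_stereoQ_pos z').ne'
    ext i
    fin_cases i
    · refine mul_left_cancel₀ hq0 ?_
      change _ * z 0 = _ * z' 0
      rw [stereoQ_mul_zero, ← es, ← stereoQ_mul_zero, eq]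
    · refine mul_left_cancel₀ hq0 ?_
      change _ * z 1 = _ * z' 1
      rw [stereoQ_mul_one, ← ep, ← stereoQ_mul_one, eq]
  have hSd := contDiff_stereoS.differentiable (by simp)
  have hPd := contDiff_stereoP.differentiable (by simp)
  have hQd := contDiff_stereoQ.differentiable (by simp)
  have hbd : ∀ z, HasFDerivAt (fun z => b (stereoS z))
      (deriv b (stereoS z) • fderiv ℝ stereoS z) z := fun z =>
    ((hb _ (stereoS_mem z)).differentiableAt (by simp)).hasDerivAt.comp_hasFDerivAt z
      (hSd z).hasFDerivAt
  have hmd : ∀ z v, fderiv ℝ m z v = b (stereoS z) * fderiv ℝ stereoP z v +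
      stereoP z * (deriv b (stereoS z) * fderiv ℝ stereoS z v) := fun z v => by
    have e1 : HasFDerivAt m _ z := (hbd z).mul (hPd z).hasFDerivAt
    rw [e1.fderiv]
    simp
  have hhd : ∀ z v, fderiv ℝ h z v = b (stereoS z) * fderiv ℝ stereoQ z v +
      stereoQ z * (deriv b (stereoS z) * fderiv ℝ stereoS z v) := fun z v => by
    have e1 : HasFDerivAt h _ z := (hbd z).mul (hQd z).hasFDerivAt
    rw [e1.fderiv]
    simp
  have hwd : ∀ z v, fderiv ℝ w z v = fderiv ℝ stereoS z v • deriv u (stereoS z) := fun z v => by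
    have e1 : HasFDerivAt w _ z := ((hu _ (stereoS_mem z)).differentiableAt
      (by simp)).hasDerivAt.hasFDerivAt.comp z (hSd z).hasFDerivAt
    rw [e1.fderiv]
    simp
  have himmφ : ∀ z, Function.Injective (fderiv ℝ φ z) := by
    intro z
    rw [injective_iff_map_eq_zero]
    intro v hv
    have ey : fderiv ℝ y z v = 0 := by
      rw [funext hyφ]
      refine fderiv_apply_eq_zero_of_comp (g := fun x => Θ (π x)) ?_ (hφd z) hv
      refine DifferentiableAt.comp (φ z) ?_ π.differentiableAt
      rw [hπφ]
      exact hΘ _ (hy0 z)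
    have hyd : DifferentiableAt ℝ y z := hys.differentiable (by simp) z
    have hnd : DifferentiableAt ℝ (fun x : E3 => ‖x‖) (y z) :=
      (contDiffAt_norm ℝ (hy0 z)).differentiableAt (n := ∞) (by simp)
    have em : fderiv ℝ m z v = 0 := by
      rw [funext hmy]
      exact fderiv_apply_eq_zero_of_comp (g := fun x : E3 => Real.log ‖x‖)
        (hnd.log (norm_ne_zero_iff.2 (hy0 z))) hyd ey
    have ew : fderiv ℝ w z v = 0 := by
      rw [funext hwy]
      exact fderiv_apply_eq_zero_of_comp (g := fun x : E3 => ‖x‖⁻¹ • x)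
        ((hnd.inv (norm_ne_zero_iff.2 (hy0 z))).smul differentiableAt_id) hyd ey
    have eh : fderiv ℝ h z v = 0 :=
      fderiv_apply_eq_zero_of_comp (g := fun x : E4 => x 3)
        ((contDiff_euclidean_apply 3).differentiable (n := ∞) (by simp) _) (hφd z) hv
    have esph : stereoS z * fderiv ℝ stereoS z v + stereoP z * fderiv ℝ stereoP z v +
        stereoQ z * fderiv ℝ stereoQ z v = 0 := by
      have e1 := (((hSd z).hasFDerivAt.pow 2).add ((hPd z).hasFDerivAt.pow 2)).add
        ((hQd z).hasFDerivAt.pow 2)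
      have e2 : HasFDerivAt (fun z => stereoS z ^ 2 + stereoP z ^ 2 + stereoQ z ^ 2)
          (0 : E2 →L[ℝ] ℝ) z := by
        rw [funext stereo_sq]
        exact hasFDerivAt_const _ _
      have e3 := congrArg (fun A => A v) (e1.unique e2)
      simp at e3
      linarith
    rw [hmd] at em
    rw [hhd] at eh
    rw [hwd] at ew
    have hbz := hb0 _ (stereoS_mem z)
    -- If dS(v) ≠ 0 then u' = 0. Eliminating dP and dQ by means of S² + P² + Q² = 1 leaves b'(1 -
    -- S²) = bS, which `himm` excludes.
    have hS0 : fderiv ℝ stereoS z v = 0 := by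
      by_contra hne
      refine himm _ (stereoS_mem z) ((smul_eq_zero.1 ew).resolve_left hne)
        (mul_left_cancel₀ hne ?_)
      have e1 := stereo_sq z
      have e2 : 1 - stereoS z ^ 2 = stereoP z ^ 2 + stereoQ z ^ 2 := by linarith
      rw [e2]
      linear_combination stereoP z * em + stereoQ z * eh - b (stereoS z) * esph
    have hP0 : fderiv ℝ stereoP z v = 0 := by
      rw [hS0] at em
      simpa [hbz.ne'] using em
    have hQ0 : fderiv ℝ stereoQ z v = 0 := by
      rw [hS0] at eh
      simpa [hbz.ne'] using eh
    have hcoord : ∀ i : Fin 2, ∀ f : E2 → ℝ, (∀ z, (1 + stereoQ z) * z i = f z) →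
        fderiv ℝ f z v = 0 → v i = 0 := by
      intro i f hf hf0
      have e1 : HasFDerivAt (fun z : E2 => z i) (EuclideanSpace.proj (𝕜 := ℝ) i) z :=
        (EuclideanSpace.proj (𝕜 := ℝ) i).hasFDerivAt
      have e2 := ((hQd z).hasFDerivAt.const_add 1).mul e1
      have e3 : HasFDerivAt f _ z := e2.congr_of_eventuallyEq
        (Filter.Eventually.of_forall fun z => (hf z).symm)
      rw [e3.fderiv] at hf0
      simp [hQ0] at hf0
      exact hf0.resolve_left (one_add_stereoQ_pos z).ne'
    ext i
    fin_cases i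
    exacts [hcoord 0 _ stereoQ_mul_zero hS0, hcoord 1 _ stereoQ_mul_one hP0]
  have hwithin : ∀ z ∈ disk, fderivWithin ℝ φ disk z = fderiv ℝ φ z := by
    intro z hz
    refine (hφd z).fderivWithin (uniqueDiffOn_convex (convex_closedBall _ _) ?_ z hz)
    rw [interior_closedBall _ one_ne_zero]
    exact ⟨0, Metric.mem_ball_self one_pos⟩
  have hNz : ∀ z : E2, stereoDenom z = 1 + ‖z‖ ^ 2 := fun z => by
    rw [norm_sq_eq, stereoDenom, add_assoc]
  have hQball : ∀ z ∈ Metric.ball (0 : E2) 1, 0 < stereoQ z := by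
    intro z hz
    rw [mem_ball_zero_iff] at hz
    have e1 := stereoDenom_pos z
    rw [stereoQ, sub_pos, lt_div_iff₀ e1, hNz]
    nlinarith [norm_nonneg z]
  have hsphere : ∀ z : E2, z 0 ^ 2 + z 1 ^ 2 = 1 →
      stereoS z = z 0 ∧ stereoP z = z 1 ∧ stereoQ z = 0 := by
    intro z hz
    have e1 : stereoDenom z = 2 := by rw [stereoDenom]; linarith
    refine ⟨?_, ?_, ?_⟩
    · rw [stereoS, e1]; ring
    · rw [stereoP, e1]; ring
    · rw [stereoQ, e1]; ring
  have hmem : ∀ z : E2, z ∈ Metric.sphere (0 : E2) 1 ↔ z 0 ^ 2 + z 1 ^ 2 = 1 := fun z => by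
    rw [mem_sphere_zero_iff_norm, ← norm_sq_eq]
    constructor
    · intro e
      rw [e, one_pow]
    · intro e
      nlinarith [norm_nonneg z]
  have hφsphere : ∀ z : E2, z 0 ^ 2 + z 1 ^ 2 = 1 →
      φ z = inclE3 (Ψ (Real.exp (b (z 0) * z 1) • u (z 0))) := by
    intro z hz
    obtain ⟨e1, e2, e3⟩ := hsphere z hz
    simp only [hφ, hy, hm, hw, hh, e1, e2, e3, mul_zero]
    rfl
  refine ⟨φ, hφs.contDiffOn, hinjφ.injOn, fun z hz => ?_, fun z hz => ?_, ?_, fun z hz => ?_⟩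
  · rw [hwithin z hz]
    exact himmφ z
  · exact mul_pos (hb0 _ (stereoS_mem z)) (hQball z hz)
  · ext x
    constructor
    · rintro ⟨z, hz, rfl⟩
      rw [hmem] at hz
      refine ⟨_, (hJ _).2 ⟨z 0, ⟨by nlinarith [sq_nonneg (z 1)], by nlinarith [sq_nonneg (z 1)]⟩,
        z 1, by linarith, rfl⟩, (hφsphere z hz).symm⟩
    · rintro ⟨x', hx', rfl⟩
      obtain ⟨s, hs, r, hr, rfl⟩ := (hJ _).1 hx'
      refine ⟨!₂[s, r], (hmem _).2 ?_, ?_⟩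
      · simp only [Matrix.cons_val_zero, Matrix.cons_val_one]
        linarith
      · refine hφsphere _ ?_
        simp only [Matrix.cons_val_zero, Matrix.cons_val_one]
        linarith
  · have hz1 := (hmem z).1 hz
    -- The radial direction. On the boundary Q = 0, so the derivative of the height is b·dQ, and 1 +
    -- Q = 2/(1 + ‖z‖²) has nonzero radial derivative there.
    refine ⟨z, ?_⟩
    rw [hwithin z (Metric.sphere_subset_closedBall hz)]
    have e1 : fderiv ℝ φ z z 3 = fderiv ℝ h z z := by
      have e2 : HasFDerivAt h ((EuclideanSpace.proj (𝕜 := ℝ) (3 : Fin 4)).comp (fderiv ℝ φ z)) z :=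
        (EuclideanSpace.proj (𝕜 := ℝ) (3 : Fin 4)).hasFDerivAt.comp z (hφd z).hasFDerivAt
      rw [e2.fderiv]
      rfl
    obtain ⟨e2, e3, e4⟩ := hsphere z hz1
    rw [e1, hhd, e4, zero_mul, add_zero]
    refine mul_ne_zero (hb0 _ (stereoS_mem z)).ne' fun hQ0 => ?_
    have f1 : ∀ i : Fin 2, HasFDerivAt (fun z : E2 => z i) (EuclideanSpace.proj (𝕜 := ℝ) i) z :=
      fun i => (EuclideanSpace.proj (𝕜 := ℝ) i).hasFDerivAt
    have f2 : HasFDerivAt stereoDenom _ z :=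
      (((f1 0).pow 2).const_add 1).add ((f1 1).pow 2)
    have f3 := ((hQd z).hasFDerivAt.const_add 1).mul f2
    have f4 : HasFDerivAt (fun z => (1 + stereoQ z) * stereoDenom z) (0 : E2 →L[ℝ] ℝ) z := by
      rw [funext one_add_stereoQ_mul]
      exact hasFDerivAt_const _ _
    have f5 := congrArg (fun A => A z) (f3.unique f4)
    simp [hQ0, e4] at f5
    nlinarith

end Hemisphere

/-! ### Reparametrizing arcs and tuning the radial coordinate near the ends. -/

section Reparametrization

/-- On `[a, b]` the curve `κ` is an injective reparametrization of the curve `γ` on `[a', b']`. -/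
structure IsReparam {X : Type*} (κ γ : ℝ → X) (a b a' b' : ℝ) : Prop where
  injOn : Set.InjOn κ (Set.Icc a b)
  image : κ '' Set.Icc a b = γ '' Set.Icc a' b'
  left : κ a = γ a'
  right : κ b = γ b'

/-- Injectivity of γ on the whole interval prevents the two pieces from meeting anywhere but at the
common endpoint. -/
theorem IsReparam.trans {X : Type*} {κ γ : ℝ → X} {a b c a' b' c' : ℝ}
    (h : IsReparam κ γ a b a' b') (h' : IsReparam κ γ b c b' c') (hab : a ≤ b) (hbc : b ≤ c)
    (hab' : a' ≤ b') (hbc' : b' ≤ c') (hγ : Set.InjOn γ (Set.Icc a' c')) :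
    IsReparam κ γ a c a' c' := by
  have cross : ∀ s ∈ Set.Icc a b, ∀ t ∈ Set.Icc b c, κ s = κ t → s = t := by
    intro s hs t ht hst
    obtain ⟨s', hs', es⟩ : κ s ∈ γ '' Set.Icc a' b' := h.image ▸ ⟨s, hs, rfl⟩
    obtain ⟨t', ht', et⟩ : κ t ∈ γ '' Set.Icc b' c' := h'.image ▸ ⟨t, ht, rfl⟩
    have e : s' = t' := hγ ⟨hs'.1, hs'.2.trans hbc'⟩ ⟨hab'.trans ht'.1, ht'.2⟩
      (by rw [es, et, hst])
    have e' : s' = b' := le_antisymm hs'.2 (e ▸ ht'.1)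
    have e1 : s = b := h.injOn hs ⟨hab, le_rfl⟩ (by rw [← es, e', h.right])
    have e2 : t = b := h'.injOn ht ⟨le_rfl, hbc⟩ (by rw [← et, ← e, e', h'.left])
    rw [e1, e2]
  refine ⟨?_, ?_, h.left, h'.right⟩
  · intro s hs t ht hst
    rcases le_total s b with h1 | h1 <;> rcases le_total t b with h2 | h2
    · exact h.injOn ⟨hs.1, h1⟩ ⟨ht.1, h2⟩ hst
    · exact cross s ⟨hs.1, h1⟩ t ⟨h2, ht.2⟩ hst
    · exact (cross t ⟨ht.1, h2⟩ s ⟨h1, hs.2⟩ hst.symm).symm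
    · exact h'.injOn ⟨h1, hs.2⟩ ⟨h2, ht.2⟩ hst
  · rw [← Set.Icc_union_Icc_eq_Icc hab hbc, Set.image_union, h.image, h'.image, ← Set.image_union,
      Set.Icc_union_Icc_eq_Icc hab' hbc']

/-- Two strictly monotone motions between the same points of a line. -/
theorem isReparam_of_strictMonoOn {κ γ : ℝ → E3} {f g : ℝ → ℝ} {a b a' b' : ℝ} (hab : a ≤ b)
    (hab' : a' ≤ b') (hf : StrictMonoOn f (Set.Icc a b)) (hfc : ContinuousOn f (Set.Icc a b))
    (hg : StrictMonoOn g (Set.Icc a' b')) (hgc : ContinuousOn g (Set.Icc a' b'))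
    (hκ : ∀ s ∈ Set.Icc a b, κ s = f s • axis) (hγ : ∀ s ∈ Set.Icc a' b', γ s = g s • axis)
    (hl : f a = g a') (hr : f b = g b') : IsReparam κ γ a b a' b' := by
  have ha := hκ a ⟨le_rfl, hab⟩
  have hb := hκ b ⟨hab, le_rfl⟩
  have ha' := hγ a' ⟨le_rfl, hab'⟩
  have hb' := hγ b' ⟨hab', le_rfl⟩
  refine ⟨?_, ?_, by rw [ha, ha', hl], by rw [hb, hb', hr]⟩
  · intro s hs t ht hst
    rw [hκ s hs, hκ t ht] at hst
    exact hf.injOn hs ht (smul_left_injective ℝ axis_ne_zero hst)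
  · rw [Set.image_congr hκ, Set.image_congr hγ, ← Function.comp_def (· • axis) f,
      ← Function.comp_def (· • axis) g, Set.image_comp, Set.image_comp,
      hfc.image_Icc_of_monotoneOn hab hf.monotoneOn,
      hgc.image_Icc_of_monotoneOn hab' hg.monotoneOn, hl, hr]

/-- A smooth even cutoff function, equal to `0` on `[-r, r]` and to `1` near `±1`. -/
noncomputable def endCutoff (r s : ℝ) : ℝ :=
  Real.smoothTransition (2 * (s ^ 2 - r ^ 2) / (1 - r ^ 2))

theorem contDiff_endCutoff (r : ℝ) : ContDiff ℝ ∞ (endCutoff r) :=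
  Real.smoothTransition.contDiff.comp (by fun_prop)

theorem endCutoff_nonneg (r s : ℝ) : 0 ≤ endCutoff r s := Real.smoothTransition.nonneg _

theorem endCutoff_le_one (r s : ℝ) : endCutoff r s ≤ 1 := Real.smoothTransition.le_one _

theorem endCutoff_eq_zero {r s : ℝ} (hr : r ^ 2 < 1) (hs : s ^ 2 ≤ r ^ 2) : endCutoff r s = 0 :=
  Real.smoothTransition.zero_of_nonpos
    (div_nonpos_of_nonpos_of_nonneg (by linarith) (by linarith))

theorem endCutoff_eq_one {r s : ℝ} (hr : r ^ 2 < 1) (hs : (1 + r ^ 2) / 2 ≤ s ^ 2) :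
    endCutoff r s = 1 :=
  Real.smoothTransition.one_of_one_le ((one_le_div (by linarith)).2 (by linarith))

theorem deriv_endCutoff_mul_nonneg {r : ℝ} (hr : r ^ 2 < 1) (s : ℝ) :
    0 ≤ deriv (endCutoff r) s * s := by
  have h0 : HasDerivAt (fun s : ℝ => 2 * (s ^ 2 - r ^ 2) / (1 - r ^ 2)) (4 * s / (1 - r ^ 2)) s := by
    have := (((hasDerivAt_pow 2 s).sub_const (r ^ 2)).const_mul 2).div_const (1 - r ^ 2)
    refine this.congr_deriv ?_
    push_cast
    ring
  have h1 : HasDerivAt (endCutoff r) _ s :=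
    ((Real.smoothTransition.contDiff (n := ⊤)).differentiable (by simp) _).hasDerivAt.comp s h0
  rw [h1.deriv]
  have h2 : 0 ≤ deriv Real.smoothTransition (2 * (s ^ 2 - r ^ 2) / (1 - r ^ 2)) :=
    Real.smoothTransition.monotone.deriv_nonneg
  have h3 : 0 < 1 - r ^ 2 := by linarith
  have h4 : 4 * s / (1 - r ^ 2) * s = 4 * s ^ 2 / (1 - r ^ 2) := by ring
  rw [mul_assoc, h4]
  positivity

/-- The factor by which a radial coordinate `n` near `±1` is made proportional to `√(1 - s ^ 2)`. -/
noncomputable def spunFactor (c r : ℝ) (n : ℝ → ℝ) (s : ℝ) : ℝ :=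
  c * endCutoff r s + (1 - endCutoff r s) * (n s / √(1 - s ^ 2))

section SpunFactor

variable {c r : ℝ} {n : ℝ → ℝ}

theorem spunFactor_eventuallyEq (hr : r ^ 2 < 1) {s : ℝ} (hs : (1 + r ^ 2) / 2 < s ^ 2) :
    spunFactor c r n =ᶠ[nhds s] fun _ => c := by
  have h : ∀ᶠ t in nhds s, (1 + r ^ 2) / 2 < t ^ 2 :=
    (continuous_pow 2).continuousAt.eventually (lt_mem_nhds hs)
  filter_upwards [h] with t ht
  rw [spunFactor, endCutoff_eq_one hr ht.le]
  ring

/-- The quotient by √(1 - s²) is singular only at ±1, and near those points the factor is the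
constant c. -/
theorem contDiffAt_spunFactor (hr : r ^ 2 < 1) {s : ℝ} (hn : ContDiffAt ℝ ∞ n s) :
    ContDiffAt ℝ ∞ (spunFactor c r n) s := by
  rcases lt_or_ge ((1 + r ^ 2) / 2) (s ^ 2) with hs | hs
  · exact contDiffAt_const.congr_of_eventuallyEq (spunFactor_eventuallyEq hr hs)
  · have h1 : 0 < 1 - s ^ 2 := by linarith
    have h2 : ContDiffAt ℝ ∞ (fun s : ℝ => √(1 - s ^ 2)) s :=
      ContDiffAt.sqrt (by fun_prop) h1.ne'
    exact (contDiffAt_const.mul (contDiff_endCutoff r).contDiffAt).add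
      ((contDiffAt_const.sub (contDiff_endCutoff r).contDiffAt).mul
        (hn.div h2 (Real.sqrt_pos.2 h1).ne'))

theorem spunFactor_pos (hr : r ^ 2 < 1) (hc : 0 < c) {s : ℝ} (hs : s ^ 2 ≤ 1) (hn : 0 < n s) :
    0 < spunFactor c r n s := by
  rcases hs.eq_or_lt with h | h
  · rw [(spunFactor_eventuallyEq hr (by linarith)).eq_of_nhds]
    exact hc
  · have h1 : 0 < n s / √(1 - s ^ 2) := div_pos hn (Real.sqrt_pos.2 (by linarith))
    rw [spunFactor]
    have h2 := endCutoff_nonneg r s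
    have h3 := endCutoff_le_one r s
    rcases h2.eq_or_lt with h4 | h4
    · rw [← h4]
      linarith
    · have := mul_pos hc h4
      have := mul_nonneg (sub_nonneg.2 h3) h1.le
      linarith

/-- The radial coordinate interpolates between c√(1 - s²) near the ends and n in the middle. At s =
±1, where the quotient is a division by zero, its weight 1 - χ vanishes. -/
theorem spunFactor_mul_sqrt (hr : r ^ 2 < 1) {s : ℝ} (hs : s ^ 2 ≤ 1) :
    spunFactor c r n s * √(1 - s ^ 2) =
      c * endCutoff r s * √(1 - s ^ 2) + (1 - endCutoff r s) * n s := by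
  rcases hs.eq_or_lt with h | h
  · rw [h, sub_self, Real.sqrt_zero, mul_zero, mul_zero, endCutoff_eq_one hr (by linarith)]
    ring
  · have h1 : √(1 - s ^ 2) ≠ 0 := (Real.sqrt_pos.2 (by linarith)).ne'
    rw [spunFactor]
    field_simp

theorem hasDerivAt_sqrt_one_sub_sq {s : ℝ} (hs : s ^ 2 < 1) :
    HasDerivAt (fun s : ℝ => √(1 - s ^ 2)) (-s / √(1 - s ^ 2)) s := by
  have h := ((hasDerivAt_pow 2 s).const_sub 1).sqrt (by linarith)
  refine h.congr_deriv ?_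
  push_cast
  have : √(1 - s ^ 2) ≠ 0 := (Real.sqrt_pos.2 (by linarith)).ne'
  field_simp

/-- The radial coordinate increases towards `s = 0` where `n` does. -/
theorem deriv_spunFactor_mul_sqrt_mul_neg (hr : r ^ 2 < 1) (hc : 0 < c) {s : ℝ} (hs : s ^ 2 < 1)
    (hs0 : s ≠ 0) (hn : DifferentiableAt ℝ n s) (hcn : c ≤ n s) (hn' : deriv n s * s < 0) :
    deriv (fun s => spunFactor c r n s * √(1 - s ^ 2)) s * s < 0 := by
  have hev : (fun s => spunFactor c r n s * √(1 - s ^ 2)) =ᶠ[nhds s] fun s =>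
      c * endCutoff r s * √(1 - s ^ 2) + (1 - endCutoff r s) * n s := by
    have h : ∀ᶠ t : ℝ in nhds s, t ^ 2 < 1 :=
      (continuous_pow 2).continuousAt.eventually (gt_mem_nhds hs)
    filter_upwards [h] with t ht
    exact spunFactor_mul_sqrt hr ht.le
  have hχ : HasDerivAt (endCutoff r) (deriv (endCutoff r) s) s :=
    ((contDiff_endCutoff r).differentiable (by simp) s).hasDerivAt
  have hd := ((hχ.const_mul c).mul (hasDerivAt_sqrt_one_sub_sq hs)).add
    ((hχ.const_sub 1).mul hn.hasDerivAt)
  have hd' : HasDerivAt (fun s => c * endCutoff r s * √(1 - s ^ 2) + (1 - endCutoff r s) * n s)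
    _ s := hd
  rw [hev.deriv_eq, hd'.deriv]
  have hq0 : 0 < √(1 - s ^ 2) := Real.sqrt_pos.2 (by linarith)
  have hq1 : √(1 - s ^ 2) ≤ 1 := Real.sqrt_le_one.2 (by nlinarith)
  set q := √(1 - s ^ 2)
  set χ := endCutoff r s
  set χ' := deriv (endCutoff r) s
  have e0 : 0 ≤ χ := endCutoff_nonneg r s
  have e1 : χ ≤ 1 := endCutoff_le_one r s
  have e2 : 0 ≤ χ' * s := deriv_endCutoff_mul_nonneg hr s
  -- The first term has the right sign because c q ≤ c ≤ n(s). Strictness comes from the second term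
  -- if χ > 0 and from the third if χ = 0.
  have e3 : (c * χ' * q + c * χ * (-s / q) + (-χ' * n s + (1 - χ) * deriv n s)) * s =
      -(χ' * s * (n s - c * q)) - χ * (c * s ^ 2 / q) - (1 - χ) * (-(deriv n s * s)) := by
    field_simp
    ring
  have e4 : 0 ≤ χ' * s * (n s - c * q) := mul_nonneg e2 (by nlinarith)
  have e5 : 0 < c * s ^ 2 / q := by positivity
  rw [e3]
  rcases e0.eq_or_lt with h | h
  · rw [← h]
    linarith
  · have := mul_pos h e5
    have := mul_nonneg (sub_nonneg.2 e1) (neg_pos.2 hn').le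
    linarith

end SpunFactor

end Reparametrization

/-! ### Smooth spun coordinates for the exterior arc. -/

section ExteriorArc

theorem OrientedKnot.injOn_exterior (k : OrientedKnot) : Set.InjOn k.toFun (Set.Icc (1 / 2) 1) := by
  intro s hs t ht hst
  obtain ⟨n, rfl⟩ := k.injective s t hst
  have e1 : (n : ℝ) < 1 := by linarith [hs.1, ht.2]
  have e2 : (-1 : ℝ) < n := by linarith [hs.2, ht.1]
  have e3 : n < 1 := by exact_mod_cast e1
  have e4 : -1 < n := by exact_mod_cast e2
  have : n = 0 := by omega
  simp [this]

namespace OrientedKnot.InSumPosition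

variable {k : OrientedKnot} (hk : k.InSumPosition)
include hk

/-- Near its ends, the exterior arc runs monotonically along the axis. -/
theorem exists_straight_ends : ∃ ε : ℝ, 0 < ε ∧ ε < 1 / 8 ∧
    (∀ t, |t - 1 / 2| ≤ 2 * ε → ‖k.toFun t‖ < 2 ∧ 0 < deriv k.toFun t 0 ∧ 0 < k.toFun t 0) ∧
    (∀ t, |t - 1| ≤ 2 * ε → ‖k.toFun t‖ < 2 ∧ 0 < deriv k.toFun t 0 ∧ k.toFun t 0 < 0) := by
  have h1 : ∀ᶠ t in nhds (1 / 2 : ℝ), 0 < k.toFun t 0 := by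
    refine (k.contDiff_coord 0).continuous.continuousAt.eventually (lt_mem_nhds ?_)
    change 0 < k.toFun (1 / 2) 0
    rw [hk.leave]
    simp [axis]
  have h2 : ∀ᶠ t in nhds (1 : ℝ), k.toFun t 0 < 0 := by
    refine (k.contDiff_coord 0).continuous.continuousAt.eventually (gt_mem_nhds ?_)
    change k.toFun 1 0 < 0
    rw [hk.toFun_one]
    simp [axis]
  obtain ⟨δ₁, hδ₁, H₁⟩ := Metric.eventually_nhds_iff_ball.1 (hk.eventually_half.and h1)
  obtain ⟨δ₂, hδ₂, H₂⟩ := Metric.eventually_nhds_iff_ball.1 (hk.eventually_one.and h2)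
  set δ := min δ₁ δ₂ with hδ
  have hδ0 : 0 < δ := lt_min hδ₁ hδ₂
  have g1 : min (δ / 4) (1 / 16) ≤ δ / 4 := min_le_left _ _
  have g2 : min (δ / 4) (1 / 16 : ℝ) ≤ 1 / 16 := min_le_right _ _
  have g3 : δ ≤ δ₁ := min_le_left _ _
  have g4 : δ ≤ δ₂ := min_le_right _ _
  refine ⟨min (δ / 4) (1 / 16), lt_min (by linarith) (by norm_num), by linarith,
    fun t ht => ?_, fun t ht => ?_⟩
  · obtain ⟨⟨a, b⟩, c⟩ := H₁ t (by rw [Metric.mem_ball, Real.dist_eq]; linarith)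
    exact ⟨a, b, c⟩
  · obtain ⟨⟨a, b⟩, c⟩ := H₂ t (by rw [Metric.mem_ball, Real.dist_eq]; linarith)
    exact ⟨a, b, c⟩

/-- Polar coordinates for the exterior arc that are adapted to half-spinning. -/
theorem exists_spun_coordinates : ∃ (b : ℝ → ℝ) (u : ℝ → E3),
    (∀ s ∈ Set.Icc (-1 : ℝ) 1, ContDiffAt ℝ ∞ b s) ∧
    (∀ s ∈ Set.Icc (-1 : ℝ) 1, ContDiffAt ℝ ∞ u s) ∧
    (∀ s ∈ Set.Icc (-1 : ℝ) 1, 0 < b s) ∧ (∀ s ∈ Set.Icc (-1 : ℝ) 1, ‖u s‖ = 1) ∧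
    (∀ s ∈ Set.Icc (-1 : ℝ) 1, deriv u s = 0 → deriv b s * (1 - s ^ 2) - b s * s ≠ 0) ∧
    IsReparam (fun s => Real.exp (b s * √(1 - s ^ 2)) • u s) k.toFun (-1) 1 (1 / 2) 1 := by
  obtain ⟨ε, hε, hε8, hl, hr⟩ := hk.exists_straight_ends
  -- l maps [-1, 1] onto [1/2 + ε, 1 - ε], where the norm exceeds 1 strictly, so n is bounded below
  -- by a positive constant. The values l(∓r) are 1/2 + 2ε and 1 - 2ε.
  set a : ℝ := 1 / 4 - ε with ha
  have ha0 : 0 < a := by rw [ha]; linarith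
  set r : ℝ := (1 / 4 - 2 * ε) / a with hrdef
  have har : a * r = 1 / 4 - 2 * ε := by rw [hrdef, mul_div_cancel₀ _ ha0.ne']
  have hr0 : 0 < r := div_pos (by linarith) ha0
  have hr1 : r < 1 := by rw [hrdef, div_lt_one ha0]; linarith
  have hr2 : r ^ 2 < 1 := by nlinarith
  set l : ℝ → ℝ := fun s => 3 / 4 + a * s with hldef
  have hlmem : ∀ s ∈ Set.Icc (-1 : ℝ) 1, l s ∈ Set.Ioo (1 / 2 : ℝ) 1 := fun s hs => by
    have e1 := mul_le_mul_of_nonneg_left hs.1 ha0.le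
    have e2 := mul_le_mul_of_nonneg_left hs.2 ha0.le
    simp only [hldef]
    constructor <;> linarith
  have hld : ∀ s, HasDerivAt l a s := fun s => by
    have h : HasDerivAt l (a * 1) s := ((hasDerivAt_id s).const_mul a).const_add (3 / 4)
    rwa [mul_one] at h
  have hls : ContDiff ℝ ∞ l := by fun_prop
  have hkl : ContDiff ℝ ∞ fun s => k.toFun (l s) := k.smooth.comp hls
  have hkld : ∀ s, HasDerivAt (fun s => k.toFun (l s)) (a • deriv k.toFun (l s)) s := fun s =>
    (k.differentiable (l s)).hasDerivAt.scomp s (hld s)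
  have hX : ∀ s, HasDerivAt (fun s => k.toFun (l s) 0) (deriv k.toFun (l s) 0 * a) s := fun s =>
    (k.hasDerivAt_coord 0 (l s)).comp s (hld s)
  have hn1 : ∀ s ∈ Set.Icc (-1 : ℝ) 1, 1 < ‖k.toFun (l s)‖ := fun s hs =>
    hk.one_lt_norm (hlmem s hs)
  have hne : ∀ s ∈ Set.Icc (-1 : ℝ) 1, k.toFun (l s) ≠ 0 := fun s hs => by
    rw [← norm_pos_iff]
    linarith [hn1 s hs]
  set n : ℝ → ℝ := fun s => Real.log ‖k.toFun (l s)‖ with hn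
  set u : ℝ → E3 := fun s => ‖k.toFun (l s)‖⁻¹ • k.toFun (l s) with hu
  have hnorms : ∀ s ∈ Set.Icc (-1 : ℝ) 1, ContDiffAt ℝ ∞ (fun s => ‖k.toFun (l s)‖) s :=
    fun s hs => hkl.contDiffAt.norm ℝ (hne s hs)
  have hns : ∀ s ∈ Set.Icc (-1 : ℝ) 1, ContDiffAt ℝ ∞ n s := fun s hs =>
    (hnorms s hs).log (norm_ne_zero_iff.2 (hne s hs))
  have hus : ∀ s ∈ Set.Icc (-1 : ℝ) 1, ContDiffAt ℝ ∞ u s := fun s hs =>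
    ((hnorms s hs).inv (norm_ne_zero_iff.2 (hne s hs))).smul hkl.contDiffAt
  have hnpos : ∀ s ∈ Set.Icc (-1 : ℝ) 1, 0 < n s := fun s hs => Real.log_pos (hn1 s hs)
  have hncont : ContinuousOn n (Set.Icc (-1) 1) := fun s hs =>
    (hns s hs).continuousAt.continuousWithinAt
  have hexpn : ∀ s ∈ Set.Icc (-1 : ℝ) 1, Real.exp (n s) = ‖k.toFun (l s)‖ := fun s hs =>
    Real.exp_log (norm_pos_iff.2 (hne s hs))
  have hpolar : ∀ s ∈ Set.Icc (-1 : ℝ) 1, Real.exp (n s) • u s = k.toFun (l s) := fun s hs => by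
    rw [hexpn s hs, hu]
    simp only
    rw [smul_smul, mul_inv_cancel₀ (norm_ne_zero_iff.2 (hne s hs)), one_smul]
  -- The minimum of n serves as c: then c√(1 - s²) ≤ n, which keeps A monotone on the end pieces.
  obtain ⟨s₀, hs₀, hmin⟩ := isCompact_Icc.exists_isMinOn ⟨0, by norm_num, by norm_num⟩ hncont
  set c := n s₀ with hc
  have hc0 : 0 < c := hnpos s₀ hs₀
  have hcn : ∀ s ∈ Set.Icc (-1 : ℝ) 1, c ≤ n s := fun s hs => hmin hs
  set b := spunFactor c r n with hb
  have hsq : ∀ s ∈ Set.Icc (-1 : ℝ) 1, s ^ 2 ≤ 1 := fun s hs => by nlinarith [hs.1, hs.2]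
  have hbs : ∀ s ∈ Set.Icc (-1 : ℝ) 1, ContDiffAt ℝ ∞ b s := fun s hs =>
    contDiffAt_spunFactor hr2 (hns s hs)
  set A : ℝ → ℝ := fun s => b s * √(1 - s ^ 2) with hA
  have hAcont : ContinuousOn A (Set.Icc (-1) 1) :=
    ContinuousOn.mul (fun s hs => (hbs s hs).continuousAt.continuousWithinAt)
      (Continuous.continuousOn (by fun_prop))
  have hAd : ∀ s ∈ Set.Icc (-1 : ℝ) 1, s ^ 2 < 1 →
      HasDerivAt A (deriv b s * √(1 - s ^ 2) + b s * (-s / √(1 - s ^ 2))) s := fun s hs hs1 =>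
    ((hbs s hs).differentiableAt (by simp)).hasDerivAt.mul (hasDerivAt_sqrt_one_sub_sq hs1)
  have hAmid : ∀ s ∈ Set.Icc (-r) r, A s = n s := fun s hs => by
    have h1 : s ^ 2 ≤ r ^ 2 := by nlinarith [hs.1, hs.2]
    simp only [hA, hb]
    rw [spunFactor_mul_sqrt hr2 (h1.trans hr2.le), endCutoff_eq_zero hr2 h1]
    ring
  have hA1 : A 1 = 0 := by simp [hA]
  have hAm1 : A (-1) = 0 := by simp [hA]
  have hleft : ∀ s ∈ Set.Icc (-1) (-r), ‖k.toFun (l s)‖ < 2 ∧ 0 < deriv k.toFun (l s) 0 ∧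
      0 < k.toFun (l s) 0 := fun s hs => by
    have e1 := mul_le_mul_of_nonneg_left hs.1 ha0.le
    have e2 := mul_le_mul_of_nonneg_left hs.2 ha0.le
    refine hl _ ?_
    simp only [hldef]
    rw [abs_le]
    constructor <;> linarith
  have hright : ∀ s ∈ Set.Icc r 1, ‖k.toFun (l s)‖ < 2 ∧ 0 < deriv k.toFun (l s) 0 ∧
      k.toFun (l s) 0 < 0 := fun s hs => by
    have e1 := mul_le_mul_of_nonneg_left hs.1 ha0.le
    have e2 := mul_le_mul_of_nonneg_left hs.2 ha0.le
    refine hr _ ?_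
    simp only [hldef]
    rw [abs_le]
    constructor <;> linarith
  have hnorm : ∀ t, ‖k.toFun t‖ < 2 → ‖k.toFun t‖ = |k.toFun t 0| := fun t ht => by
    rw [hk.eq_smul_axis ht.le, norm_smul_axis, smul_axis_zero]
  have hn' : ∀ s, ‖k.toFun (l s)‖ < 2 → k.toFun (l s) 0 ≠ 0 →
      deriv n s = deriv k.toFun (l s) 0 * a / k.toFun (l s) 0 := fun s hs hs0 => by
    have h1 : n =ᶠ[nhds s] fun s => Real.log (k.toFun (l s) 0) := by
      filter_upwards [hkl.continuous.norm.continuousAt.eventually (gt_mem_nhds hs)] with t ht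
      simp only [hn]
      rw [hnorm _ ht, Real.log_abs]
    rw [h1.deriv_eq, ((hX s).log hs0).deriv]
  have hnleft : ∀ s ∈ Set.Icc (-1) (-r), deriv n s * s < 0 := fun s hs => by
    obtain ⟨h1, h2, h3⟩ := hleft s hs
    rw [hn' s h1 h3.ne']
    exact mul_neg_of_pos_of_neg (div_pos (mul_pos h2 ha0) h3) (by linarith [hs.2])
  have hnright : ∀ s ∈ Set.Icc r 1, deriv n s * s < 0 := fun s hs => by
    obtain ⟨h1, h2, h3⟩ := hright s hs
    rw [hn' s h1 h3.ne]
    exact mul_neg_of_neg_of_pos (div_neg_of_pos_of_neg (mul_pos h2 ha0) h3) (by linarith [hs.1])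
  have hA' : ∀ s ∈ Set.Ioo (-1 : ℝ) 1, (s ≤ -r ∨ r ≤ s) → deriv A s * s < 0 := fun s hs h => by
    have hs' := Set.Ioo_subset_Icc_self hs
    have e1 : s ^ 2 < 1 := by nlinarith [hs.1, hs.2]
    refine deriv_spunFactor_mul_sqrt_mul_neg hr2 hc0 e1 ?_ ((hns s hs').differentiableAt (by simp))
      (hcn s hs') ?_
    · rintro rfl
      rcases h with h | h <;> linarith
    · rcases h with h | h
      · exact hnleft s ⟨hs.1.le, h⟩
      · exact hnright s ⟨h, hs.2.le⟩
  have himm : ∀ s ∈ Set.Icc (-1 : ℝ) 1, deriv u s = 0 →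
      deriv b s * (1 - s ^ 2) - b s * s ≠ 0 := by
    intro s hs hus0 hE
    rcases (hsq s hs).eq_or_lt with h1 | h1
    · have e1 : b =ᶠ[nhds s] fun _ => c := spunFactor_eventuallyEq hr2 (by linarith)
      rw [e1.eq_of_nhds, h1, sub_self, mul_zero, zero_sub, neg_eq_zero] at hE
      have : s ≠ 0 := by rintro rfl; norm_num at h1
      exact mul_ne_zero hc0.ne' this hE
    · have hq : 0 < √(1 - s ^ 2) := Real.sqrt_pos.2 (by linarith)
      have hq2 : √(1 - s ^ 2) ^ 2 = 1 - s ^ 2 := Real.sq_sqrt (by linarith)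
      have hA0 : deriv A s = 0 := by
        rw [(hAd s hs h1).deriv]
        field_simp
        rw [hq2]
        linarith
      have hs' : s ∈ Set.Ioo (-1 : ℝ) 1 := ⟨by nlinarith [hs.1], by nlinarith [hs.2]⟩
      by_cases h2 : s ≤ -r ∨ r ≤ s
      · have := hA' s hs' h2
        rw [hA0, zero_mul] at this
        exact lt_irrefl _ this
      -- In the middle the curve is `k ∘ l` itself, so vanishing radial and angular derivatives
      -- would contradict the immersion property of k.
      · push Not at h2
        have e1 : A =ᶠ[nhds s] n := by
          filter_upwards [Ioo_mem_nhds h2.1 h2.2] with t ht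
          exact hAmid t (Set.Ioo_subset_Icc_self ht)
        have e2 : deriv n s = 0 := by rw [← e1.deriv_eq, hA0]
        have e3 : HasDerivAt (fun s => Real.exp (n s) • u s) 0 s := by
          have f1 := ((hns s hs).differentiableAt (by simp)).hasDerivAt.exp.smul
            ((hus s hs).differentiableAt (by simp)).hasDerivAt
          rw [e2, hus0] at f1
          refine f1.congr_deriv ?_
          simp
        have e4 : (fun s => k.toFun (l s)) =ᶠ[nhds s] fun s => Real.exp (n s) • u s := by
          filter_upwards [Ioo_mem_nhds hs'.1 hs'.2] with t ht
          exact (hpolar t (Set.Ioo_subset_Icc_self ht)).symm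
        have e5 := (hkld s).unique (e3.congr_of_eventuallyEq e4)
        exact k.immersion _ ((smul_eq_zero.1 e5).resolve_left ha0.ne')
  have hll : l (-r) = 1 / 2 + 2 * ε := by simp only [hldef]; linarith
  have hlr : l r = 1 - 2 * ε := by simp only [hldef]; linarith
  have hmr : -r ∈ Set.Icc (-1 : ℝ) 1 := ⟨by linarith, by linarith⟩
  have hpr : r ∈ Set.Icc (-1 : ℝ) 1 := ⟨by linarith, by linarith⟩
  have hXmono : ∀ t₀ t₁ : ℝ, (∀ t ∈ Set.Icc t₀ t₁, 0 < deriv k.toFun t 0) →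
      StrictMonoOn (fun t => k.toFun t 0) (Set.Icc t₀ t₁) := fun t₀ t₁ h =>
    strictMonoOn_of_deriv_pos (convex_Icc _ _) (k.contDiff_coord 0).continuous.continuousOn
      fun t ht => by
        rw [interior_Icc] at ht
        rw [(k.hasDerivAt_coord 0 t).deriv]
        exact h t (Set.Ioo_subset_Icc_self ht)
  -- Here the new curve departs from `k ∘ l`: it starts on the unit sphere although l(-1) = 1/2 + ε.
  -- Both curves move monotonically along the axis between the same points. The other end is
  -- similar.
  have Pleft : IsReparam (fun s => Real.exp (A s) • u s) k.toFun (-1) (-r) (1 / 2)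
      (1 / 2 + 2 * ε) := by
    have hsub : Set.Icc (-1) (-r) ⊆ Set.Icc (-1 : ℝ) 1 := Set.Icc_subset_Icc_right (by linarith)
    have hstr : ∀ t ∈ Set.Icc (1 / 2) (1 / 2 + 2 * ε), |t - 1 / 2| ≤ 2 * ε := fun t ht => by
      rw [abs_le]
      constructor <;> linarith [ht.1, ht.2]
    refine isReparam_of_strictMonoOn (f := fun s => Real.exp (A s)) (g := fun t => k.toFun t 0)
      (by linarith) (by linarith) ?_ (hAcont.mono hsub).rexp
      (hXmono _ _ fun t ht => (hl t (hstr t ht)).2.1)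
      (k.contDiff_coord 0).continuous.continuousOn ?_ ?_ ?_ ?_
    · refine Real.exp_strictMono.comp_strictMonoOn ?_
      refine strictMonoOn_of_deriv_pos (convex_Icc _ _) (hAcont.mono hsub) fun s hs => ?_
      rw [interior_Icc] at hs
      have := hA' s ⟨hs.1, by linarith [hs.2]⟩ (Or.inl hs.2.le)
      exact pos_of_mul_neg_left this (by linarith [hs.2])
    · intro s hs
      obtain ⟨h1, h2, h3⟩ := hleft s hs
      have e1 : u s = axis := by
        simp only [hu]
        rw [hnorm _ h1, abs_of_pos h3]
        nth_rw 2 [hk.eq_smul_axis h1.le]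
        rw [smul_smul, inv_mul_cancel₀ h3.ne', one_smul]
      simp only [e1]
    · exact fun t ht => hk.eq_smul_axis (hl t (hstr t ht)).1.le
    · simp only [hAm1, hk.leave, Real.exp_zero]
      simp [axis]
    · simp only
      obtain ⟨h1, h2, h3⟩ := hleft (-r) ⟨hmr.1, le_rfl⟩
      rw [hAmid _ ⟨le_rfl, by linarith⟩, hexpn _ hmr, hnorm _ h1, abs_of_pos h3, hll]
  have Pright : IsReparam (fun s => Real.exp (A s) • u s) k.toFun r 1 (1 - 2 * ε) 1 := by
    have hsub : Set.Icc r 1 ⊆ Set.Icc (-1 : ℝ) 1 := Set.Icc_subset_Icc_left (by linarith)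
    have hstr : ∀ t ∈ Set.Icc (1 - 2 * ε) 1, |t - 1| ≤ 2 * ε := fun t ht => by
      rw [abs_le]
      constructor <;> linarith [ht.1, ht.2]
    refine isReparam_of_strictMonoOn (f := fun s => -Real.exp (A s)) (g := fun t => k.toFun t 0)
      hr1.le (by linarith) ?_ (hAcont.mono hsub).rexp.neg
      (hXmono _ _ fun t ht => (hr t (hstr t ht)).2.1)
      (k.contDiff_coord 0).continuous.continuousOn ?_ ?_ ?_ ?_
    · have : StrictAntiOn (fun s => Real.exp (A s)) (Set.Icc r 1) := by
        refine Real.exp_strictMono.comp_strictAntiOn ?_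
        refine strictAntiOn_of_deriv_neg (convex_Icc _ _) (hAcont.mono hsub) fun s hs => ?_
        rw [interior_Icc] at hs
        have := hA' s ⟨by linarith [hs.1], hs.2⟩ (Or.inr hs.1.le)
        exact neg_of_mul_neg_left this (by linarith [hs.1])
      exact this.neg
    · intro s hs
      obtain ⟨h1, h2, h3⟩ := hright s hs
      have e1 : u s = -axis := by
        simp only [hu]
        rw [hnorm _ h1, abs_of_neg h3]
        nth_rw 2 [hk.eq_smul_axis h1.le]
        rw [smul_smul, inv_neg, neg_mul, inv_mul_cancel₀ h3.ne, neg_one_smul]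
      simp only [e1, smul_neg, neg_smul]
    · exact fun t ht => hk.eq_smul_axis (hr t (hstr t ht)).1.le
    · simp only
      obtain ⟨h1, h2, h3⟩ := hright r ⟨le_rfl, hr1.le⟩
      rw [hAmid _ ⟨by linarith, le_rfl⟩, hexpn _ hpr, hnorm _ h1, abs_of_neg h3, hlr, neg_neg]
    · simp [hA1, hk.toFun_one, axis]
  have Pmid : IsReparam (fun s => Real.exp (A s) • u s) k.toFun (-r) r (1 / 2 + 2 * ε)
      (1 - 2 * ε) := by
    have hsub : Set.Icc (-r) r ⊆ Set.Icc (-1 : ℝ) 1 := Set.Icc_subset_Icc hmr.1 hpr.2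
    have hκ : ∀ s ∈ Set.Icc (-r) r, Real.exp (A s) • u s = k.toFun (l s) := fun s hs => by
      rw [hAmid s hs, hpolar s (hsub hs)]
    refine ⟨?_, ?_, ?_, ?_⟩
    · intro s hs t ht hst
      simp only [hκ s hs, hκ t ht] at hst
      have := k.injOn_exterior (Set.Ioo_subset_Icc_self (hlmem s (hsub hs)))
        (Set.Ioo_subset_Icc_self (hlmem t (hsub ht))) hst
      simp only [hldef] at this
      exact mul_left_cancel₀ ha0.ne' (add_left_cancel this)
    · rw [Set.image_congr hκ, ← Function.comp_def k.toFun l, Set.image_comp]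
      have e1 : MonotoneOn l (Set.Icc (-r) r) := fun s _ t _ hst => by
        simp only [hldef]
        linarith [mul_le_mul_of_nonneg_left hst ha0.le]
      rw [hls.continuous.continuousOn.image_Icc_of_monotoneOn (by linarith) e1, hll, hlr]
    · simp only [hκ (-r) ⟨le_rfl, by linarith⟩, hll]
    · simp only [hκ r ⟨by linarith, le_rfl⟩, hlr]
  refine ⟨b, u, hbs, hus, fun s hs => spunFactor_pos hr2 hc0 (hsq s hs) (hnpos s hs),
    fun s hs => ?_, himm, ?_⟩
  · simp only [hu]
    rw [norm_smul, norm_inv, norm_norm, inv_mul_cancel₀ (norm_ne_zero_iff.2 (hne s hs))]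
  · exact (Pleft.trans Pmid (by linarith) (by linarith) (by linarith) (by linarith)
      (k.injOn_exterior.mono (Set.Icc_subset_Icc_right (by linarith)))).trans Pright
      (by linarith) (by linarith) (by linarith) (by linarith) k.injOn_exterior

end OrientedKnot.InSumPosition

end ExteriorArc

/-! ### Gluing, and the proof of the proposition. -/

section ConnectedSums

theorem gluing_eq (p : E3) : gluing p = (‖p‖ ^ 2)⁻¹ • reflectCLM p := by
  rw [gluing, reflectCLM_apply]

theorem gluing_ne_zero {p : E3} (hp : p ≠ 0) : gluing p ≠ 0 := by
  rw [gluing_eq, smul_ne_zero_iff, ← norm_ne_zero_iff (a := reflectCLM p), norm_reflectCLM,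
    norm_ne_zero_iff]
  exact ⟨inv_ne_zero (pow_ne_zero 2 (norm_ne_zero_iff.2 hp)), hp⟩

theorem gluing_gluing {p : E3} (hp : p ≠ 0) : gluing (gluing p) = p := by
  have h : ‖p‖ ≠ 0 := norm_ne_zero_iff.2 hp
  rw [gluing_eq (gluing p), gluing_eq p, norm_smul, norm_reflectCLM, map_smul,
    reflectCLM_reflectCLM, smul_smul, norm_inv, norm_pow, norm_norm]
  have : ((((‖p‖ ^ 2)⁻¹ * ‖p‖) ^ 2)⁻¹ * (‖p‖ ^ 2)⁻¹) = 1 := by field_simp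
  rw [this, one_smul]

theorem contDiffAt_gluing {p : E3} (hp : p ≠ 0) : ContDiffAt ℝ ∞ gluing p := by
  rw [funext gluing_eq]
  exact ((contDiff_norm_sq ℝ).contDiffAt.inv (pow_ne_zero 2 (norm_ne_zero_iff.2 hp))).smul
    reflectCLM.contDiff.contDiffAt

/-- This describes the exterior arc without its parametrization, which a diffeomorphism of the
underlying sets need not respect. -/
theorem OrientedKnot.InSumPosition.mem_exterior_iff {k : OrientedKnot} (hk : k.InSumPosition)
    (x : E3) : x ∈ k.toFun '' Set.Icc (1 / 2) 1 ↔ x ∈ Set.range k.toFun ∧ 1 ≤ ‖x‖ := by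
  constructor
  · rintro ⟨t, ht, rfl⟩
    exact ⟨⟨t, rfl⟩, hk.one_le_norm ht⟩
  · rintro ⟨⟨t, rfl⟩, hx⟩
    have e1 : k.toFun (Int.fract t) = k.toFun t := by
      rw [← k.toFun_add_int (Int.fract t) ⌊t⌋, Int.fract_add_floor]
    rw [← e1] at hx ⊢
    have h0 := Int.fract_nonneg t
    have h1 := Int.fract_lt_one t
    rcases le_or_gt (1 / 2) (Int.fract t) with h | h
    · exact ⟨_, ⟨h, h1.le⟩, rfl⟩
    · rcases h0.eq_or_lt with h2 | h2
      · exact ⟨1, ⟨by norm_num, le_rfl⟩, by rw [hk.toFun_one, ← h2, hk.enter]⟩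
      · exact absurd hx (not_le.2 (hk.inside _ ⟨h2, h⟩))

theorem OrientedKnot.mem_range_of_connectedSum {k₁ k₂ j : OrientedKnot}
    (h₂ : ∀ t ∈ Set.Icc (0 : ℝ) (1 / 2), j.toFun t = gluing (k₂.toFun (t + 1 / 2)))
    (h₁ : ∀ t ∈ Set.Icc (1 / 2 : ℝ) 1, j.toFun t = k₁.toFun t) (x : E3) :
    x ∈ Set.range j.toFun ↔ x ∈ k₁.toFun '' Set.Icc (1 / 2) 1 ∨
      x ∈ gluing '' (k₂.toFun '' Set.Icc (1 / 2) 1) := by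
  constructor
  · rintro ⟨t, rfl⟩
    have e1 : j.toFun (Int.fract t) = j.toFun t := by
      rw [← j.toFun_add_int (Int.fract t) ⌊t⌋, Int.fract_add_floor]
    rw [← e1]
    have h0 := Int.fract_nonneg t
    have h1 := Int.fract_lt_one t
    rcases le_or_gt (1 / 2) (Int.fract t) with h | h
    · exact Or.inl ⟨_, ⟨h, h1.le⟩, (h₁ _ ⟨h, h1.le⟩).symm⟩
    · exact Or.inr ⟨_, ⟨_, ⟨by linarith, by linarith⟩, rfl⟩, (h₂ _ ⟨h0, h.le⟩).symm⟩
  · rintro (⟨t, ht, rfl⟩ | ⟨_, ⟨t, ht, rfl⟩, rfl⟩)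
    · exact ⟨t, h₁ t ht⟩
    · refine ⟨t - 1 / 2, ?_⟩
      rw [h₂ _ ⟨by linarith [ht.1], by linarith [ht.2]⟩, sub_add_cancel]

end ConnectedSums

theorem mainTheorem5 (K J : OrientedKnot)
    (hJ : OrientedKnot.IsConnectedSum K K.mirrorReverse J) : J.BoundsDisk := by
  obtain ⟨k₁, k₂, j, i₁, i₂, i₃, p₁, p₂, hj₂, hj₁⟩ := hJ
  obtain ⟨f, hf, hf', hfball, hfk⟩ := exists_standard_diffeo i₁ i₂ p₁ p₂
  obtain ⟨g, hg, cg⟩ := i₃.exists_carries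
  obtain ⟨b, u, hb, hu, hb0, hu1, himm, hκ⟩ := p₁.exists_spun_coordinates
  have hf0 : f 0 = 0 := by rw [hfball 0 (by simp), map_zero]
  have hfne : ∀ x ≠ 0, f x ≠ 0 := fun x hx h => hx (f.injective (h.trans hf0.symm))
  -- As an involution of the open unit ball, f also preserves the complement of that ball.
  have hfnorm : ∀ x, 1 ≤ ‖f x‖ ↔ 1 ≤ ‖x‖ := by
    intro x
    rw [← not_lt, ← not_lt, not_iff_not]
    constructor
    · intro h
      have h1 : ‖reflectCLM (f x)‖ < 1 := by rwa [norm_reflectCLM]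
      have h2 : f (reflectCLM (f x)) = f x := by rw [hfball _ h1.le, reflectCLM_reflectCLM]
      rwa [f.injective h2] at h1
    · intro h
      rwa [hfball x h.le, norm_reflectCLM]
  have hext : ∀ x, x ∈ k₁.toFun '' Set.Icc (1 / 2) 1 ↔ f x ∈ k₂.toFun '' Set.Icc (1 / 2) 1 :=
    fun x => by rw [p₁.mem_exterior_iff, p₂.mem_exterior_iff, hfk, hfnorm]
  have hgJ : ∀ y, y ∈ Set.range J.toFun ↔ g y ∈ Set.range j.toFun := fun y => by
    rw [← J.exists_mem_tangents_iff, ← j.exists_mem_tangents_iff, cg.exists_mem_iff hg]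
  -- In the unit ball the reflections in f and `gluing` cancel; the inversion left over changes the
  -- sign of the log radius.
  have hinner : ∀ s ∈ Set.Icc (-1 : ℝ) 1,
      gluing (f (Real.exp (b s * -√(1 - s ^ 2)) • u s)) = Real.exp (b s * √(1 - s ^ 2)) • u s := by
    intro s hs
    have e1 : ‖Real.exp (b s * -√(1 - s ^ 2)) • u s‖ = Real.exp (b s * -√(1 - s ^ 2)) := by
      rw [norm_smul, hu1 s hs, mul_one, Real.norm_eq_abs, Real.abs_exp]
    have e2 : Real.exp (b s * -√(1 - s ^ 2)) ≤ 1 := by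
      rw [Real.exp_le_one_iff, mul_neg, neg_nonpos]
      exact mul_nonneg (hb0 s hs).le (Real.sqrt_nonneg _)
    rw [hfball _ (e1.trans_le e2), gluing_eq, norm_reflectCLM, reflectCLM_reflectCLM, e1, smul_smul,
      mul_neg, Real.exp_neg]
    congr 1
    have := Real.exp_ne_zero (b s * √(1 - s ^ 2))
    field_simp
  -- Under `gluing` ∘ f the half r ≥ 0 of the boundary becomes the glued arc of `k₂` and the half r
  -- ≤ 0 becomes the exterior arc of `k₁`. Since `gluing` is an involution away from 0, Θ inverts Ψ
  -- there.
  refine OrientedKnot.boundsDisk_of_arc hb hu hb0 hu1 hκ.injOn himm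
    (Ψ := fun x => g.symm (gluing (f x))) (Θ := fun y => f.symm (gluing (g y))) ?_ ?_ ?_ ?_
  · intro x hx
    exact (orientedDiffeo.contDiff_symm hg).contDiffAt.comp x
      ((contDiffAt_gluing (hfne x hx)).comp x hf.contDiffAt)
  · intro x hx
    simp only [g.apply_symm_apply]
    rw [gluing_gluing (hfne x hx), f.symm_apply_apply]
  · intro x hx
    refine ContDiffAt.differentiableAt (n := ∞) ?_ (by simp)
    have h1 : ContDiffAt ℝ ∞ gluing (g (g.symm (gluing (f x)))) := by
      rw [g.apply_symm_apply]
      exact contDiffAt_gluing (gluing_ne_zero (hfne x hx))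
    exact hf'.contDiffAt.comp _ (h1.comp _ (orientedDiffeo.contDiff hg).contDiffAt)
  · intro y
    rw [hgJ, OrientedKnot.mem_range_of_connectedSum hj₂ hj₁, ← hκ.image]
    constructor
    · rintro (⟨s, hs, h⟩ | ⟨z, hz, h⟩)
      · refine ⟨s, hs, -√(1 - s ^ 2), ?_, ?_⟩
        · rw [neg_sq, Real.sq_sqrt (by nlinarith [hs.1, hs.2])]
        · rw [Equiv.eq_symm_apply, hinner s hs]
          exact h.symm
      · rw [← f.apply_symm_apply z, ← hext, ← hκ.image] at hz
        obtain ⟨s, hs, h'⟩ := hz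
        refine ⟨s, hs, √(1 - s ^ 2), Real.sq_sqrt (by nlinarith [hs.1, hs.2]), ?_⟩
        rw [Equiv.eq_symm_apply, ← h]
        congr 1
        rw [← f.symm_apply_eq]
        exact h'.symm
    · rintro ⟨s, hs, r, hr, rfl⟩
      rw [g.apply_symm_apply]
      rcases le_total 0 r with h | h
      · rw [← Real.sqrt_sq h, hr]
        exact Or.inr ⟨_, (hext _).1 (hκ.image ▸ ⟨s, hs, rfl⟩), rfl⟩
      · have e1 : r = -√(1 - s ^ 2) := by
          rw [← hr, ← neg_sq, Real.sqrt_sq (by linarith), neg_neg]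
        rw [e1, hinner s hs]
        exact Or.inl ⟨s, hs, rfl⟩
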